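/- For a space $X$ and an integer $k\ge 1$ let $\exp_k(X)$ be the set of nonempty finite subsets of $X$ of cardinality at most $k$, with the quotient topology of the map $X^k\to\exp_k(X)$, $(x_1,\dots,x_k)\mapsto\{x_1\}\cup\dots\cup\{x_k\}$; for $l\le k$ regard $\exp_l(X)$ as a subset of $\exp_k(X)$, and let $\exp_0(X)=\emptyset$. Let $k\ge 2$. Then $\exp_k(S^1)\setminus\exp_{k-2}(S^1)$ has the homotopy type of a $(k-1,k)$-torus knot complement, that is, of $S^3\setminus\{(z^{k-1},z^{k})/\sqrt2 : z\in S^1\}$, where $S^3$ is the unit sphere of $\mathbb C^2$. More precisely, let $\Delta=\{(a_0,a_1,\dots,a_{k-1})\in\mathbb R^k : 0=a_0\le a_1\le\dots\le a_{k-1}\le 1\}$, a $(k-1)$-simplex with vertices $v_i=(0,\dots,0,1,\dots,1)$ ($i$ ones, $0\le i\le k-1$). Let $\beta$ be the barycentre of $\Delta$, let $\beta_i$ be the barycentre of the face of $\Delta$ opposite to $v_i$, and let $B=\bigcup_{i=0}^{k-1}[\beta,\beta_i]$ be the star graph formed by the segments from $\beta$ to the $\beta_i$. Let $q:\Delta\times[0,1]\to\exp_k(S^1)$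 be the map $$q(a,t)=\{\,e^{2\pi i (a_j+(1-a_{k-1})t)} : 0\le j\le k-1\,\}.$$ Then $q(B\times[0,1])$ is contained in $\exp_k(S^1)\setminus\exp_{k-2}(S^1)$ and is a strong deformation retract of it; and $q(B\times[0,1])$ is homeomorphic to the $2$-complex with two $0$-cells $u,v$, three $1$-cells $a$ (a loop at $u$), $b$ (a loop at $v$) and $c$ (from $u$ to $v$), and one $2$-cell, attached along $a^{k-1}cb^{-k}c^{-1}$. -/

import Mathlib

open scoped unitInterval

noncomputable section

/-! ### Finite subset spaces -/

/-- `exp_k(X)`: the nonempty finite subsets of `X` of cardinality at most `k`. -/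
def FiniteSubsetSpace (k : ℕ) (X : Type*) : Type _ :=
  {s : Set X // s.Nonempty ∧ s.Finite ∧ s.ncard ≤ k}

namespace FiniteSubsetSpace

/-- The natural map `X^k → exp_k(X)`, `(x_1, …, x_k) ↦ {x_1} ∪ ⋯ ∪ {x_k}`. -/
def ofTuple {k : ℕ} [NeZero k] {X : Type*} (x : Fin k → X) : FiniteSubsetSpace k X :=
  ⟨Set.range x, Set.range_nonempty x, Set.finite_range x, by
    rw [← Set.image_univ]
    refine (Set.ncard_image_le Set.finite_univ).trans ?_
    simp [Set.ncard_univ]⟩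

/-- `exp_k(X)` carries the quotient topology of the natural map from `X^k`. -/
instance {k : ℕ} [NeZero k] {X : Type*} [TopologicalSpace X] :
    TopologicalSpace (FiniteSubsetSpace k X) :=
  TopologicalSpace.coinduced (ofTuple : (Fin k → X) → FiniteSubsetSpace k X) inferInstance

/-- The natural inclusion `exp_l(X) ↪ exp_k(X)` for `l ≤ k`. -/
def incl {l k : ℕ} (h : l ≤ k) {X : Type*} (s : FiniteSubsetSpace l X) :
    FiniteSubsetSpace k X :=
  ⟨s.1, s.2.1, s.2.2.1, s.2.2.2.trans h⟩

end FiniteSubsetSpace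

/-- The complement of `exp_{k-2}(S¹)` in `exp_k(S¹)`
(for `k = 2` nothing is removed, since `exp_0(S¹)` is empty). -/
def codimTwoComplement (k : ℕ) : Set (FiniteSubsetSpace k Circle) :=
  (Set.range (FiniteSubsetSpace.incl (X := Circle) (Nat.sub_le k 2)))ᶜ

/-! ### Torus knots -/

/-- The unit sphere `S³` in `ℂ²`. -/
abbrev ThreeSphere : Type := Metric.sphere (0 : EuclideanSpace ℂ (Fin 2)) 1

/-- The `(p, q)`-torus knot `{ (z^p, z^q) / √2 : z ∈ S¹ }` in `S³`
(a knot whenever `p` and `q` are coprime). -/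
def torusKnot (p q : ℕ) : Set ThreeSphere :=
  {x | ∃ z : Circle, x.1 0 = (z : ℂ) ^ p / (Real.sqrt 2 : ℂ) ∧
    x.1 1 = (z : ℂ) ^ q / (Real.sqrt 2 : ℂ)}

/-! ### Deformation retracts -/

/-- `A` is a (strong) deformation retract of `Y`: the identity of `Y` is homotopic, relative
to `A`, to a map with values in `A`. -/
def IsDeformationRetract {Y : Type*} [TopologicalSpace Y] (A : Set Y) : Prop :=
  ∃ r : C(Y, Y), (∀ y, r y ∈ A) ∧ (ContinuousMap.id Y).HomotopicRel r A

/-! ### Two-dimensional cell complexes with one 2-cell -/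

/-- The identifications that attach the edges `e` (copies of `[0,1]`) to the vertices
`src e`, `tgt e`, and the boundary of a closed disc along the edge path `w`. A letter `(e, true)`
of `w` runs along `e` from source to target, a letter `(e, false)` runs backwards. The boundary
circle is divided into `w.length` arcs of equal length, and the `i`-th one is mapped to the
`i`-th edge of `w`. -/
inductive TwoComplex.Rel {V E : Type} (src tgt : E → V) (w : List (E × Bool)) :
    V ⊕ (E × I) ⊕ Metric.closedBall (0 : ℂ) 1 → V ⊕ (E × I) ⊕ Metric.closedBall (0 : ℂ) 1 → Prop
  | source (e : E) : Rel src tgt w (Sum.inr (Sum.inl (e, 0))) (Sum.inl (src e))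
  | target (e : E) : Rel src tgt w (Sum.inr (Sum.inl (e, 1))) (Sum.inl (tgt e))
  | boundary (i : Fin w.length) (t : I) (z : Metric.closedBall (0 : ℂ) 1)
      (hz : (z : ℂ) =
        (Circle.exp (2 * Real.pi * (((i : ℕ) : ℝ) + (t : ℝ)) / (w.length : ℝ)) : ℂ)) :
      Rel src tgt w (Sum.inr (Sum.inr z))
        (Sum.inr (Sum.inl ((w.get i).1, if (w.get i).2 then t else unitInterval.symm t)))

/-- The cell complex with 0-cells `V`, 1-cells `E` and one 2-cell attached along the closed edge
path `w`, with the quotient topology (`V` and `E` are meant to be discrete). -/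
def TwoComplex {V E : Type} (src tgt : E → V) (w : List (E × Bool)) : Type :=
  Quot (TwoComplex.Rel src tgt w)

instance {V E : Type} [TopologicalSpace V] [TopologicalSpace E] (src tgt : E → V)
    (w : List (E × Bool)) : TopologicalSpace (TwoComplex src tgt w) :=
  inferInstanceAs (TopologicalSpace (Quot (TwoComplex.Rel src tgt w)))

/-- Two 0-cells. -/
inductive TorusVertex
  | u
  | v

/-- Three 1-cells. -/
inductive TorusEdge
  | a
  | b
  | c

instance : TopologicalSpace TorusVertex := ⊥

instance : TopologicalSpace TorusEdge := ⊥

/-- `a` is a loop at `u`, `b` is a loop at `v`, and `c` runs from `u` to `v`. -/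
def TorusEdge.src : TorusEdge → TorusVertex
  | .a => .u
  | .b => .v
  | .c => .u

/-- `a` is a loop at `u`, `b` is a loop at `v`, and `c` runs from `u` to `v`. -/
def TorusEdge.tgt : TorusEdge → TorusVertex
  | .a => .u
  | .b => .v
  | .c => .v

/-- The word `a^{k-1} c b^{-k} c^{-1}`. -/
def torusWord (k : ℕ) : List (TorusEdge × Bool) :=
  List.replicate (k - 1) (.a, true) ++ [(.c, true)] ++ List.replicate k (.b, false) ++
    [(.c, false)]

/-- The 2-complex with 1-cells `a`, `b`, `c` and one 2-cell attached along
`a^{k-1} c b^{-k} c^{-1}`. -/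
abbrev TorusComplex (k : ℕ) : Type :=
  TwoComplex TorusEdge.src TorusEdge.tgt (torusWord k)

/-! ### The subspace `q(B × I)` -/

/-- The vertex `v_i` (`0 ≤ i ≤ k - 1`) of the `(k-1)`-simplex
`Δ = {(0, a_1, …, a_{k-1}) | 0 ≤ a_1 ≤ ⋯ ≤ a_{k-1} ≤ 1}`: its last `i` coordinates are `1`, the
others are `0`. Coordinates are numbered `0, …, k - 1`, so that coordinate `0` vanishes on `Δ`. -/
def simplexVertex (k : ℕ) (i : Fin k) : Fin k → ℝ :=
  fun j => if k ≤ (i : ℕ) + (j : ℕ) then 1 else 0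

/-- The barycentre `b` of `Δ`. -/
def simplexBarycentre (k : ℕ) : Fin k → ℝ :=
  (k : ℝ)⁻¹ • ∑ i : Fin k, simplexVertex k i

/-- The barycentre `b_i` of the face of `Δ` opposite to `v_i` (for `k ≥ 2`). -/
def faceBarycentre (k : ℕ) (i : Fin k) : Fin k → ℝ :=
  ((k : ℝ) - 1)⁻¹ • ∑ j ∈ Finset.univ.erase i, simplexVertex k j

/-- The star graph `B ⊆ Δ`, the union of the segments `[b, b_i]`. -/
def starGraph (k : ℕ) : Set (Fin k → ℝ) :=
  ⋃ i : Fin k, segment ℝ (simplexBarycentre k) (faceBarycentre k i)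

/-- The map `q : Δ × [0,1] → exp_k(S¹)`,
`(a, t) ↦ { exp(2πi (a_j + (1 - a_{k-1}) t)) : 0 ≤ j ≤ k - 1 }` (with `a_0 = 0`), given by the
same formula on all of `ℝ^k × ℝ`. -/
def simplexMap (k : ℕ) [NeZero k] (p : (Fin k → ℝ) × ℝ) : FiniteSubsetSpace k Circle :=
  FiniteSubsetSpace.ofTuple fun j =>
    Circle.exp (2 * Real.pi *
      (p.1 j + (1 - p.1 ⟨k - 1, Nat.sub_one_lt (NeZero.ne k)⟩) * p.2))

/-- The subspace `q(B × [0,1])` of `exp_k(S¹)`. -/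
def starImage (k : ℕ) [NeZero k] : Set (FiniteSubsetSpace k Circle) :=
  simplexMap k '' (starGraph k ×ˢ Set.Icc (0 : ℝ) 1)

end

/-!
For `k = m + 1`, both `exp_k(S¹) ∖ exp_{k-2}(S¹)` and the complement of the `(m, m + 1)`-torus knot
deformation retract onto the same 2-complex: the double mapping cylinder of the maps `z ↦ z ^ m`
and `z ↦ z ^ (m + 1)` of the circle (`IsTorusCylinder`). Cutting this cylinder along a segment
gives a square with boundary word `a ^ m c b ^ (-(m + 1)) c⁻¹`
(`IsTorusCylinder.nonempty_homeomorph`).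

Finite subsets. A nonempty subset of the circle with at most `m + 1` points is given by its `m + 1`
gaps `s` (some possibly zero) and by the ratio `t : 1 - t` in which the angle `0` divides the gap
containing it; this is the map `q` on `Δ × [0,1]` in barycentric coordinates (`gapSet`). The
subset has at least `m` points exactly when at most one gap vanishes, that is, when the second
smallest gap `M` is positive. Then `s` is joined by a segment to the point obtained by capping
all gaps at `M` and rescaling, which has one gap `ρ / (m + ρ)` and `m` gaps `1 / (m + ρ)`, hence
lies on the star graph (`gapFlow`). This homotopy multiplies each gap by a factor depending only on
its length. It is therefore induced by the map of the circle that fixes the angle `0` and whose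
derivative at a point is that factor for the complementary arc containing the point. This map
depends only on the subset and not on the pair `(s, t)`, so the homotopy descends to subsets
(`gapSet_gapFlow_eq`, `isDeformationRetract_starImage`). A subset with gaps in the ratio
`ρ : 1 : ⋯ : 1` is determined by `ρ` and the centre `z` of the short gap; for `ρ = 0` and `ρ = 1`
it is a regular `m`-gon or `(m + 1)`-gon and only `z ^ m` or `z ^ (m + 1)` matters
(`isTorusCylinder_ringSet`).

Knot complement. Away from two core circles, a point `(z, w)` of `S³` is described by
`x = |z|² - |w|²`, the phase `y` of `z ^ (m + 1) / w ^ m` in half turns, and the phase of `w / z`.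
The pair `(x, y)` ranges over a square whose centre corresponds to the knot. Pushing radially away
from the centre retracts the knot complement onto the image of the boundary of the square
(`isDeformationRetract_spine`), which is again the double mapping cylinder
(`isTorusCylinder_spineMap`).
-/

/-! ### Homotopies and homeomorphisms induced on quotients -/

/-- A homotopy on `X` with values in `Y` descends along a proper surjection `f : X → Y` as soon as
it is constant on the fibres of `f`. Properness makes `id × f` a quotient map as well. -/
theorem IsDeformationRetract.of_isProperMap {X Y : Type*} [TopologicalSpace X]
    [TopologicalSpace Y] {f : X → Y} (hf : IsProperMap f) (hsurj : Function.Surjective f)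
    (A : Set Y) {h : I × X → Y} (hcont : Continuous h) (h_zero : ∀ x, h (0, x) = f x)
    (h_one : ∀ x, h (1, x) ∈ A) (h_fix : ∀ u x, f x ∈ A → h (u, x) = f x)
    (h_fibre : ∀ u x x', f x = f x' → h (u, x) = h (u, x')) : IsDeformationRetract A := by
  have hq : Topology.IsQuotientMap (Prod.map (id : I → I) f) :=
    (isProperMap_id.prodMap hf).isClosedMap.isQuotientMap
      (continuous_id.prodMap hf.continuous) (Function.surjective_id.prodMap hsurj)
  let g : I × Y → Y := fun p => h (p.1, Function.surjInv hsurj p.2)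
  have hg : ∀ u x, g (u, f x) = h (u, x) := fun u x =>
    h_fibre _ _ _ (Function.surjInv_eq hsurj _)
  have gcont : Continuous g := by
    rw [hq.continuous_iff]
    exact hcont.congr fun p => (hg p.1 p.2).symm
  refine ⟨⟨fun y => g (1, y), by fun_prop⟩, fun y => h_one _, ⟨⟨⟨⟨g, gcont⟩, ?_, ?_⟩, ?_⟩⟩⟩
  · intro y
    obtain ⟨x, rfl⟩ := hsurj y
    exact (hg 0 x).trans (h_zero x)
  · intro y
    rfl
  · intro u y hy
    obtain ⟨x, rfl⟩ := hsurj y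
    exact (hg u x).trans (h_fix u x hy)

/-- The inclusion of a deformation retract is a homotopy equivalence. -/
theorem IsDeformationRetract.nonempty_homotopyEquiv {Y : Type*} [TopologicalSpace Y] {A : Set Y}
    (hA : IsDeformationRetract A) : Nonempty (ContinuousMap.HomotopyEquiv A Y) := by
  obtain ⟨r, hr, ⟨H⟩⟩ := hA
  refine ⟨⟨⟨Subtype.val, continuous_subtype_val⟩, ⟨fun y => ⟨r y, hr y⟩, by fun_prop⟩, ?_, ?_⟩⟩
  · convert ContinuousMap.Homotopic.refl (ContinuousMap.id A)
    ext a
    exact (H.fst_eq_snd a.2).symm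
  · exact ⟨H.toHomotopy.symm⟩

/-- Two spaces that are quotients of the same space by the same equivalence relation are
homeomorphic. -/
theorem Topology.IsQuotientMap.nonempty_homeomorph_of_fibres {X Y Z : Type*} [TopologicalSpace X]
    [TopologicalSpace Y] [TopologicalSpace Z] {f : X → Y} {g : X → Z}
    (hf : Topology.IsQuotientMap f) (hg : Topology.IsQuotientMap g)
    (h : ∀ x x', f x = f x' ↔ g x = g x') : Nonempty (Y ≃ₜ Z) := by
  refine ⟨⟨⟨fun y => g (Function.surjInv hf.surjective y),
    fun z => f (Function.surjInv hg.surjective z), fun y => ?_, fun z => ?_⟩, ?_, ?_⟩⟩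
  · exact ((h _ _).2 (Function.surjInv_eq hg.surjective _)).trans
      (Function.surjInv_eq hf.surjective y)
  · exact ((h _ _).1 (Function.surjInv_eq hf.surjective _)).trans
      (Function.surjInv_eq hg.surjective z)
  · rw [hf.continuous_iff]
    exact hg.continuous.congr fun x => ((h _ _).1 (Function.surjInv_eq hf.surjective (f x))).symm
  · rw [hg.continuous_iff]
    exact hf.continuous.congr fun x => ((h _ _).2 (Function.surjInv_eq hg.surjective (g x))).symm

/-! ### The circle, parametrized by turns -/

/-- The point of the circle at angle `x`, measured in full turns. -/
noncomputable def turn (x : ℝ) : Circle := Circle.exp (2 * Real.pi * x)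

@[fun_prop]
theorem continuous_turn : Continuous turn := by unfold turn; fun_prop

theorem turn_add (x y : ℝ) : turn (x + y) = turn x * turn y := by
  simp [turn, mul_add, Circle.exp_add]

theorem turn_neg (x : ℝ) : turn (-x) = (turn x)⁻¹ := by simp [turn]

theorem turn_sub (x y : ℝ) : turn (x - y) = turn x / turn y := by
  rw [sub_eq_add_neg, turn_add, turn_neg, div_eq_mul_inv]

@[simp] theorem turn_zero : turn 0 = 1 := by simp [turn]

@[simp] theorem turn_one : turn 1 = 1 := by simp [turn]

theorem turn_pow (x : ℝ) (n : ℕ) : turn x ^ n = turn (n * x) := by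
  rw [turn, turn, ← Circle.exp_natCast_mul]; ring_nf

@[simp] theorem turn_intCast (n : ℤ) : turn n = 1 := Circle.exp_two_pi_mul_int n

@[simp] theorem turn_natCast (n : ℕ) : turn n = 1 := mod_cast turn_intCast n

theorem turn_eq_turn_iff {x y : ℝ} : turn x = turn y ↔ ∃ n : ℤ, x = y + n := by
  have := Real.two_pi_pos
  rw [turn, turn, Circle.exp_eq_exp]
  refine exists_congr fun n => ⟨fun h => ?_, fun h => by rw [h]; ring⟩
  apply mul_left_cancel₀ this.ne'
  linarith

theorem turn_half : turn (1 / 2) = -1 := by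
  apply Circle.ext
  rw [turn, show 2 * Real.pi * (1 / 2) = Real.pi by ring]
  simp [Circle.coe_exp]

theorem turn_neg_half : turn (-1 / 2) = -1 := by
  rw [neg_div, turn_neg, turn_half]; simp

theorem exists_turn_eq (z : Circle) : ∃ x ∈ Set.Ico (0 : ℝ) 1, turn x = z := by
  obtain ⟨θ, rfl⟩ := Circle.exp_surjective z
  refine ⟨Int.fract (θ / (2 * Real.pi)), ⟨Int.fract_nonneg _, Int.fract_lt_one _⟩, ?_⟩
  have h : turn (θ / (2 * Real.pi)) = Circle.exp θ := by
    rw [turn, mul_div_cancel₀ _ Real.two_pi_pos.ne']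
  rw [← h, turn_eq_turn_iff]
  exact ⟨-⌊θ / (2 * Real.pi)⌋, by rw [Int.fract]; push_cast; ring⟩

theorem exists_pow_eq {d : ℕ} (hd : d ≠ 0) (z : Circle) : ∃ w : Circle, w ^ d = z := by
  obtain ⟨x, -, rfl⟩ := exists_turn_eq z
  exact ⟨turn (x / d), by rw [turn_pow, mul_div_cancel₀ _ (by positivity)]⟩

/-- Two points of the circle with the same two consecutive powers coincide. -/
theorem eq_of_pow_eq_pow_succ {z w : Circle} {m : ℕ} (h₁ : z ^ m = w ^ m)
    (h₂ : z ^ (m + 1) = w ^ (m + 1)) : z = w := by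
  rw [pow_succ, pow_succ, h₁] at h₂
  exact mul_left_cancel h₂

/-- The `d`-th roots of `z ^ d`, listed with repetitions by `Fin k` for `d ≤ k`. -/
theorem range_mul_turn_div {k d : ℕ} (hd : 0 < d) (hdk : d ≤ k) (z : Circle) :
    Set.range (fun j : Fin k => z * turn ((j : ℕ) / d)) = {w | w ^ d = z ^ d} := by
  have hd' : (d : ℝ) ≠ 0 := by positivity
  ext w
  simp only [Set.mem_range, Set.mem_ofPred_eq]
  constructor
  · rintro ⟨j, rfl⟩
    rw [mul_pow, turn_pow, mul_div_cancel₀ _ hd', turn_natCast, mul_one]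
  · intro h
    obtain ⟨x, hx, hxw⟩ := exists_turn_eq (w / z)
    have h1 : turn (d * x) = turn 0 := by
      rw [← turn_pow, hxw, div_pow, h, div_self', turn_zero]
    obtain ⟨n, hn⟩ := turn_eq_turn_iff.1 h1
    rw [zero_add] at hn
    have hd0 : (0 : ℝ) < d := by positivity
    have n0 : 0 ≤ n := by
      have : (0 : ℝ) ≤ n := hn ▸ mul_nonneg hd0.le hx.1
      exact_mod_cast this
    obtain ⟨i, rfl⟩ := Int.eq_ofNat_of_zero_le n0
    have hi : i < d := by
      have : (i : ℝ) < d := by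
        have := mul_lt_mul_of_pos_left hx.2 hd0
        rw [hn] at this
        simpa using this
      exact_mod_cast this
    refine ⟨⟨i, hi.trans_le hdk⟩, ?_⟩
    have : (i : ℝ) / d = x := by
      rw [div_eq_iff hd', mul_comm, hn]; simp
    simp only [this, hxw, mul_div_cancel]

/-! ### Cones over closed curves -/

theorem exists_polar (z : Metric.closedBall (0 : ℂ) 1) :
    ∃ r θ : I, (z : ℂ) = (r : ℝ) * (turn θ : ℂ) ∧ (r : ℝ) = ‖(z : ℂ)‖ := by
  obtain ⟨z, hz⟩ := z
  obtain ⟨θ, hθ, h⟩ := exists_turn_eq (Circle.exp z.arg)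
  refine ⟨⟨‖z‖, norm_nonneg z, mem_closedBall_zero_iff.1 hz⟩, ⟨θ, hθ.1, hθ.2.le⟩, ?_, rfl⟩
  simp only [h, Circle.coe_exp]
  exact (Complex.norm_mul_exp_arg_mul_I z).symm

/-- A closed curve `γ : [0,1] → E` extends linearly along radii to the closed unit disc. -/
theorem exists_continuous_cone {E : Type*} [NormedAddCommGroup E] [NormedSpace ℝ E] {γ : ℝ → E}
    (hγ : Continuous γ) (hγ' : γ 0 = γ 1) :
    ∃ g : Metric.closedBall (0 : ℂ) 1 → E, Continuous g ∧ ∀ (r θ : I)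
      (z : Metric.closedBall (0 : ℂ) 1), (z : ℂ) = (r : ℝ) * (turn θ : ℂ) →
        g z = (r : ℝ) • γ θ := by
  let P : I × I → Metric.closedBall (0 : ℂ) 1 := fun p =>
    ⟨((p.1 : ℝ) : ℂ) * (turn p.2 : ℂ), by
      simpa [Circle.norm_coe, abs_of_nonneg p.1.2.1] using p.1.2.2⟩
  have hP : Continuous P := by
    refine Continuous.subtype_mk ?_ _
    have : Continuous fun p : I × I => turn (p.2 : ℝ) := by fun_prop
    exact (Complex.continuous_ofReal.comp (by fun_prop)).mul (continuous_subtype_val.comp this)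
  have hsurj : Function.Surjective P := by
    intro z
    obtain ⟨r, θ, h, -⟩ := exists_polar z
    exact ⟨(r, θ), Subtype.ext h.symm⟩
  have hq : Topology.IsQuotientMap P := hP.isClosedMap.isQuotientMap hP hsurj
  -- The angle is determined by a nonzero point of the disc, up to the endpoints of `[0,1]`.
  have hfib : ∀ p p' : I × I, P p = P p' → (p.1 : ℝ) • γ p.2 = (p'.1 : ℝ) • γ p'.2 := by
    intro p p' h
    have h1 : ((p.1 : ℝ) : ℂ) * (turn p.2 : ℂ) = ((p'.1 : ℝ) : ℂ) * (turn p'.2 : ℂ) :=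
      congrArg Subtype.val h
    have hr : (p.1 : ℝ) = p'.1 := by
      have := congrArg norm h1
      simpa [Circle.norm_coe, abs_of_nonneg p.1.2.1, abs_of_nonneg p'.1.2.1] using this
    rcases eq_or_ne (p'.1 : ℝ) 0 with h0 | h0
    · rw [hr, h0, zero_smul, zero_smul]
    rw [hr] at h1 ⊢
    have h2 : turn p.2 = turn p'.2 :=
      Circle.ext (mul_left_cancel₀ (Complex.ofReal_ne_zero.2 h0) h1)
    obtain ⟨n, hn⟩ := turn_eq_turn_iff.1 h2
    have a := p.2.2
    have b := p'.2.2
    have n1 : n ≤ 1 := by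
      have : (n : ℝ) ≤ 1 := by linarith [a.2, b.1]
      exact_mod_cast this
    have n2 : -1 ≤ n := by
      have : (-1 : ℝ) ≤ n := by linarith [a.1, b.2]
      exact_mod_cast this
    congr 1
    interval_cases n
    · have e1 : (p.2 : ℝ) = 0 := by push_cast at hn; linarith [a.1, b.2]
      have e2 : (p'.2 : ℝ) = 1 := by push_cast at hn; linarith [a.1, b.2]
      rw [e1, e2, hγ']
    · rw [hn]; simp
    · have e1 : (p.2 : ℝ) = 1 := by push_cast at hn; linarith [a.2, b.1]
      have e2 : (p'.2 : ℝ) = 0 := by push_cast at hn; linarith [a.2, b.1]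
      rw [e1, e2, hγ']
  let G : C(I × I, E) := ⟨fun p => (p.1 : ℝ) • γ p.2, by fun_prop⟩
  refine ⟨hq.lift (f := ⟨P, hP⟩) G (fun p p' h => hfib p p' h), map_continuous _, ?_⟩
  intro r θ z hz
  have : z = P (r, θ) := Subtype.ext hz
  rw [this]
  exact DFunLike.congr_fun (hq.lift_comp (f := ⟨P, hP⟩) G (fun p p' h => hfib p p' h)) (r, θ)

/-- The boundary of the unit square, traversed counterclockwise from the origin on the interval
`[0, 2m+3]`. Its bottom, right, top and left sides take time `m`, `1`, `m + 1` and `1`. -/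
noncomputable def squareBoundary (m : ℕ) (τ : ℝ) : ℝ × ℝ :=
  (max 0 (min 1 (min (τ / m) ((2 * m + 2 - τ) / (m + 1)))),
    max 0 (min 1 (min (τ - m) (2 * m + 3 - τ))))

theorem continuous_squareBoundary (m : ℕ) : Continuous (squareBoundary m) := by
  unfold squareBoundary; fun_prop

section

variable {m : ℕ} {τ : ℝ}

theorem squareBoundary_bottom (hm : 1 ≤ m) (h₀ : 0 ≤ τ) (h₁ : τ ≤ m) :
    squareBoundary m τ = (τ / m, 0) := by
  have hm' : (1 : ℝ) ≤ m := by exact_mod_cast hm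
  have a : τ / m ≤ 1 := (div_le_one (by linarith)).2 h₁
  have b : 1 ≤ (2 * m + 2 - τ) / (m + 1) := (one_le_div (by linarith)).2 (by linarith)
  have c : 0 ≤ τ / m := by positivity
  rw [squareBoundary, min_eq_left (a.trans b), min_eq_right a, max_eq_right c,
    min_eq_left (by linarith : τ - m ≤ 2 * m + 3 - τ), min_eq_right (by linarith : τ - m ≤ 1),
    max_eq_left (by linarith)]

theorem squareBoundary_right (hm : 1 ≤ m) (h₀ : m ≤ τ) (h₁ : τ ≤ m + 1) :
    squareBoundary m τ = (1, τ - m) := by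
  have hm' : (1 : ℝ) ≤ m := by exact_mod_cast hm
  have a : 1 ≤ τ / m := (one_le_div (by linarith)).2 h₀
  have b : 1 ≤ (2 * m + 2 - τ) / (m + 1) := (one_le_div (by linarith)).2 (by linarith)
  rw [squareBoundary, min_eq_left (le_min a b), max_eq_right zero_le_one,
    min_eq_left (by linarith : τ - m ≤ 2 * m + 3 - τ), min_eq_right (by linarith : τ - m ≤ 1),
    max_eq_right (by linarith)]

theorem squareBoundary_top (hm : 1 ≤ m) (h₀ : m + 1 ≤ τ) (h₁ : τ ≤ 2 * m + 2) :
    squareBoundary m τ = ((2 * m + 2 - τ) / (m + 1), 1) := by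
  have hm' : (1 : ℝ) ≤ m := by exact_mod_cast hm
  have a : 1 ≤ τ / m := (one_le_div (by linarith)).2 (by linarith)
  have b : (2 * m + 2 - τ) / (m + 1) ≤ 1 := (div_le_one (by linarith)).2 (by linarith)
  have c : 0 ≤ (2 * m + 2 - τ) / (m + 1) := div_nonneg (by linarith) (by linarith)
  rw [squareBoundary, min_eq_right (b.trans a), min_eq_right b, max_eq_right c,
    min_eq_left (le_min (by linarith) (by linarith)), max_eq_right zero_le_one]

theorem squareBoundary_left (hm : 1 ≤ m) (h₀ : 2 * m + 2 ≤ τ) (h₁ : τ ≤ 2 * m + 3) :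
    squareBoundary m τ = (0, 2 * m + 3 - τ) := by
  have hm' : (1 : ℝ) ≤ m := by exact_mod_cast hm
  have a : 0 ≤ τ / m := div_nonneg (by linarith) (by linarith)
  have c : (2 * m + 2 - τ) / (m + 1) ≤ 0 := div_nonpos_of_nonpos_of_nonneg (by linarith)
    (by linarith)
  rw [squareBoundary, min_eq_right (c.trans a), min_eq_right (by linarith), max_eq_left c,
    min_eq_right (by linarith : 2 * m + 3 - τ ≤ τ - m), min_eq_right (by linarith),
    max_eq_right (by linarith)]

theorem squareBoundary_cases (hm : 1 ≤ m) (h₀ : 0 ≤ τ) (h₁ : τ ≤ 2 * m + 3) :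
    (τ ≤ m ∧ m * (squareBoundary m τ).1 = τ ∧ (squareBoundary m τ).2 = 0 ∧
      (squareBoundary m τ).1 ∈ Set.Icc (0 : ℝ) 1) ∨
    (m ≤ τ ∧ (squareBoundary m τ).1 = 1 ∧ m + (squareBoundary m τ).2 = τ ∧
      (squareBoundary m τ).2 ∈ Set.Icc (0 : ℝ) 1) ∨
    (m + 1 ≤ τ ∧ (m + 1) * (squareBoundary m τ).1 = 2 * m + 2 - τ ∧ (squareBoundary m τ).2 = 1 ∧
      (squareBoundary m τ).1 ∈ Set.Icc (0 : ℝ) 1) ∨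
    (2 * m + 2 ≤ τ ∧ (squareBoundary m τ).1 = 0 ∧ (squareBoundary m τ).2 = 2 * m + 3 - τ ∧
      (squareBoundary m τ).2 ∈ Set.Icc (0 : ℝ) 1) := by
  have hm' : (1 : ℝ) ≤ m := by exact_mod_cast hm
  rcases le_total τ m with a | a
  · left
    rw [squareBoundary_bottom hm h₀ a]
    exact ⟨a, mul_div_cancel₀ _ (by positivity), rfl, by positivity,
      (div_le_one (by linarith)).2 a⟩
  rcases le_total τ (m + 1) with b | b
  · right; left
    rw [squareBoundary_right hm a b]
    exact ⟨a, rfl, by simp, by simpa using a, by simp only; linarith⟩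
  rcases le_total τ (2 * m + 2) with c | c
  · right; right; left
    rw [squareBoundary_top hm b c]
    exact ⟨b, mul_div_cancel₀ _ (by positivity), rfl, div_nonneg (by linarith) (by linarith),
      (div_le_one (by linarith)).2 (by linarith)⟩
  · right; right; right
    rw [squareBoundary_left hm c h₁]
    exact ⟨c, rfl, rfl, by simp only; linarith, by simp only; linarith⟩

/-- The boundary curve of the square is injective apart from its endpoints. -/
theorem turn_eq_of_squareBoundary_eq (hm : 1 ≤ m) {θ θ' : ℝ} (h : θ ∈ Set.Icc (0 : ℝ) 1)
    (h' : θ' ∈ Set.Icc (0 : ℝ) 1)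
    (e : squareBoundary m ((2 * m + 3) * θ) = squareBoundary m ((2 * m + 3) * θ')) :
    turn θ = turn θ' := by
  have hm' : (1 : ℝ) ≤ m := by exact_mod_cast hm
  have hM : (0 : ℝ) < 2 * m + 3 := by positivity
  have a₀ := mul_nonneg hM.le h.1
  have a₁ := mul_le_mul_of_nonneg_left h.2 hM.le
  have b₀ := mul_nonneg hM.le h'.1
  have b₁ := mul_le_mul_of_nonneg_left h'.2 hM.le
  rw [mul_one] at a₁ b₁
  have key : (2 * (m : ℝ) + 3) * θ = (2 * m + 3) * θ' ∨
      ((2 * (m : ℝ) + 3) * θ = 0 ∧ (2 * (m : ℝ) + 3) * θ' = (2 * m + 3) * 1) ∨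
      ((2 * (m : ℝ) + 3) * θ = (2 * m + 3) * 1 ∧ (2 * (m : ℝ) + 3) * θ' = 0) := by
    have C := squareBoundary_cases hm a₀ a₁
    have C' := squareBoundary_cases hm b₀ b₁
    rw [← e] at C'
    generalize squareBoundary m ((2 * m + 3) * θ) = p at C C'
    obtain ⟨x, y⟩ := p
    simp only [Set.mem_Icc] at C C'
    generalize (2 * (m : ℝ) + 3) * θ = τ at *
    generalize (2 * (m : ℝ) + 3) * θ' = τ' at *
    rcases C with ⟨c, c₁, c₂, -⟩ | ⟨c, c₁, c₂, -⟩ | ⟨c, c₁, c₂, -⟩ | ⟨c, c₁, c₂, -⟩ <;>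
    rcases C' with ⟨d, d₁, d₂, -⟩ | ⟨d, d₁, d₂, -⟩ | ⟨d, d₁, d₂, -⟩ | ⟨d, d₁, d₂, -⟩ <;>
    first
    | (left; linarith)
    | (subst c₁; left; linarith)
    | (subst d₁; left; linarith)
    | (subst c₁; right; right; constructor <;> linarith)
    | (subst d₁; right; left; constructor <;> linarith)
  rcases key with k | ⟨k, k'⟩ | ⟨k, k'⟩
  · rw [mul_left_cancel₀ hM.ne' k]
  · rw [mul_left_cancel₀ hM.ne' k', (mul_eq_zero.1 k).resolve_left hM.ne', turn_zero, turn_one]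
  · rw [mul_left_cancel₀ hM.ne' k, (mul_eq_zero.1 k').resolve_left hM.ne', turn_zero, turn_one]

theorem exists_squareBoundary_eq (hm : 1 ≤ m) {p : ℝ × ℝ} (h₁ : p.1 ∈ Set.Icc (0 : ℝ) 1)
    (h₂ : p.2 ∈ Set.Icc (0 : ℝ) 1) (h : p.1 = 0 ∨ p.1 = 1 ∨ p.2 = 0 ∨ p.2 = 1) :
    ∃ θ ∈ Set.Icc (0 : ℝ) 1, squareBoundary m ((2 * m + 3) * θ) = p := by
  have hm' : (1 : ℝ) ≤ m := by exact_mod_cast hm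
  have hM : (0 : ℝ) < 2 * m + 3 := by positivity
  suffices ∃ τ : ℝ, 0 ≤ τ ∧ τ ≤ 2 * m + 3 ∧ squareBoundary m τ = p by
    obtain ⟨τ, a, b, rfl⟩ := this
    exact ⟨τ / (2 * m + 3), ⟨by positivity, (div_le_one hM).2 b⟩, by
      rw [mul_div_cancel₀ _ hM.ne']⟩
  obtain ⟨x, y⟩ := p
  simp only [Set.mem_Icc] at h₁ h₂ h
  rcases h with rfl | rfl | rfl | rfl
  · refine ⟨2 * m + 3 - y, by linarith, by linarith, ?_⟩
    rw [squareBoundary_left hm (by linarith) (by linarith)]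
    simp
  · refine ⟨m + y, by linarith, by linarith, ?_⟩
    rw [squareBoundary_right hm (by linarith) (by linarith)]
    simp
  · have : m * x ≤ m := mul_le_of_le_one_right (by linarith) h₁.2
    refine ⟨m * x, mul_nonneg (by linarith) h₁.1, by linarith, ?_⟩
    rw [squareBoundary_bottom hm (mul_nonneg (by linarith) h₁.1) this, mul_div_cancel_left₀]
    positivity
  · have : (m + 1) * x ≤ m + 1 := mul_le_of_le_one_right (by linarith) h₁.2
    have := mul_nonneg (by linarith : (0 : ℝ) ≤ m + 1) h₁.1
    refine ⟨2 * m + 2 - (m + 1) * x, by linarith, by linarith, ?_⟩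
    rw [squareBoundary_top hm (by linarith) (by linarith), sub_sub_cancel,
      mul_div_cancel_left₀]
    positivity

theorem norm_two_smul_squareBoundary_sub (hm : 1 ≤ m) (h₀ : 0 ≤ τ) (h₁ : τ ≤ 2 * m + 3) :
    ‖(2 : ℝ) • squareBoundary m τ - (1, 1)‖ = 1 := by
  have C := squareBoundary_cases hm h₀ h₁
  generalize squareBoundary m τ = p at C
  obtain ⟨x, y⟩ := p
  simp only [Set.mem_Icc] at C
  rw [Prod.norm_def]
  simp only [Prod.smul_mk, Prod.mk_sub_mk, smul_eq_mul, Real.norm_eq_abs]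
  rcases C with ⟨-, -, rfl, c⟩ | ⟨-, rfl, -, c⟩ | ⟨-, -, rfl, c⟩ | ⟨-, rfl, -, c⟩
  · rw [max_eq_right] <;> norm_num
    rw [abs_le]; constructor <;> linarith
  · rw [max_eq_left] <;> norm_num
    rw [abs_le]; constructor <;> linarith
  · rw [max_eq_right] <;> norm_num
    rw [abs_le]; constructor <;> linarith
  · rw [max_eq_left] <;> norm_num
    rw [abs_le]; constructor <;> linarith

end

/-- A homeomorphism (given as a continuous bijection) from the closed disc onto the unit square
whose restriction to the boundary is `squareBoundary`. -/
theorem exists_disc_to_square {m : ℕ} (hm : 1 ≤ m) :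
    ∃ g : Metric.closedBall (0 : ℂ) 1 → ℝ × ℝ, Continuous g ∧ Function.Injective g ∧
      (∀ p : ℝ × ℝ, p.1 ∈ Set.Icc (0 : ℝ) 1 → p.2 ∈ Set.Icc (0 : ℝ) 1 → ∃ z, g z = p) ∧
      (∀ z, (g z).1 ∈ Set.Icc (0 : ℝ) 1 ∧ (g z).2 ∈ Set.Icc (0 : ℝ) 1) ∧
      (∀ z : Metric.closedBall (0 : ℂ) 1, ‖(z : ℂ)‖ < 1 →
        (g z).1 ∈ Set.Ioo (0 : ℝ) 1 ∧ (g z).2 ∈ Set.Ioo (0 : ℝ) 1) ∧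
      (∀ θ ∈ Set.Icc (0 : ℝ) 1, ∀ z : Metric.closedBall (0 : ℂ) 1, (z : ℂ) = turn θ →
        g z = squareBoundary m ((2 * m + 3) * θ)) := by
  have hM : (0 : ℝ) < 2 * m + 3 := by positivity
  -- In the coordinates `2p - (1,1)` the square is the unit ball of the sup norm.
  let γ : ℝ → ℝ × ℝ := fun θ => (2 : ℝ) • squareBoundary m ((2 * m + 3) * θ) - (1, 1)
  have γcont : Continuous γ := by
    have := continuous_squareBoundary m
    fun_prop
  have γ01 : γ 0 = γ 1 := by
    simp only [γ, mul_zero, mul_one]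
    rw [squareBoundary_bottom hm le_rfl (by positivity),
      squareBoundary_left hm (by linarith) le_rfl]
    simp
  have γnorm : ∀ θ : I, ‖γ θ‖ = 1 := fun θ => norm_two_smul_squareBoundary_sub hm
    (mul_nonneg hM.le θ.2.1) (mul_le_of_le_one_right hM.le θ.2.2)
  obtain ⟨g₀, g₀cont, hg₀⟩ := exists_continuous_cone γcont γ01
  have g₀norm : ∀ z, ‖g₀ z‖ = ‖(z : ℂ)‖ := by
    intro z
    obtain ⟨r, θ, h, hr⟩ := exists_polar z
    rw [hg₀ r θ z h, norm_smul, γnorm, mul_one, ← hr, Real.norm_of_nonneg r.2.1]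
  have hhalf : ∀ z, (1 / 2 : ℝ) • (g₀ z + (1, 1)) = (((g₀ z).1 + 1) / 2, ((g₀ z).2 + 1) / 2) := by
    intro z
    ext <;> simp <;> ring
  refine ⟨fun z => (1 / 2 : ℝ) • (g₀ z + (1, 1)), by fun_prop, ?_, ?_, ?_, ?_, ?_⟩
  · intro z z' hzz
    have e : g₀ z = g₀ z' := by
      have := smul_right_injective (ℝ × ℝ) (by norm_num : (1 / 2 : ℝ) ≠ 0) hzz
      exact add_right_cancel this
    obtain ⟨r, θ, h, hr⟩ := exists_polar z
    obtain ⟨r', θ', h', hr'⟩ := exists_polar z'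
    have rr : (r : ℝ) = r' := by rw [hr, hr', ← g₀norm, e, g₀norm]
    apply Subtype.ext
    rcases eq_or_ne (r' : ℝ) 0 with h0 | h0
    · rw [h, h', rr, h0]; simp
    rw [hg₀ r θ z h, hg₀ r' θ' z' h', rr] at e
    have e' : γ θ = γ θ' := smul_right_injective _ h0 e
    have e'' := smul_right_injective (ℝ × ℝ) (two_ne_zero : (2 : ℝ) ≠ 0) (sub_left_injective e')
    rw [h, h', rr, turn_eq_of_squareBoundary_eq hm θ.2 θ'.2 e'']
  · intro p hp₁ hp₂
    let v : ℝ × ℝ := (2 : ℝ) • p - (1, 1)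
    have hv : ‖v‖ ≤ 1 := by
      simp only [v, Prod.norm_def, Prod.fst_sub, Prod.smul_fst, Prod.snd_sub, Prod.smul_snd,
        smul_eq_mul, Real.norm_eq_abs, max_le_iff, abs_le]
      refine ⟨⟨?_, ?_⟩, ?_, ?_⟩ <;> linarith [hp₁.1, hp₁.2, hp₂.1, hp₂.2]
    suffices ∃ z, g₀ z = v by
      obtain ⟨z, hz⟩ := this
      refine ⟨z, ?_⟩
      simp only [hz, v]
      ext <;> simp
    rcases eq_or_ne v 0 with h0 | h0
    · exact ⟨⟨0, by simp⟩, by rw [h0, hg₀ 0 0] <;> simp⟩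
    · let w : ℝ × ℝ := ‖v‖⁻¹ • v
      have hw : ‖w‖ = 1 := norm_smul_inv_norm h0
      have hw' : max |w.1| |w.2| = 1 := by rw [← hw, Prod.norm_def]; rfl
      have w1 : |w.1| ≤ 1 := hw' ▸ le_max_left _ _
      have w2 : |w.2| ≤ 1 := hw' ▸ le_max_right _ _
      rw [abs_le] at w1 w2
      obtain ⟨θ, hθ, hθ'⟩ := exists_squareBoundary_eq hm (p := ((w.1 + 1) / 2, (w.2 + 1) / 2))
        ⟨by simp only; linarith, by simp only; linarith⟩
        ⟨by simp only; linarith, by simp only; linarith⟩ (by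
          rcases max_choice |w.1| |w.2| with h | h <;> rw [h] at hw' <;>
            rcases eq_or_eq_neg_of_abs_eq hw' with h' | h' <;> simp [h'])
      have hγ : γ θ = w := by
        simp only [γ, hθ']
        ext <;> simp <;> ring
      refine ⟨⟨(‖v‖ : ℂ) * (turn θ : ℂ), by simpa [Circle.norm_coe] using hv⟩, ?_⟩
      rw [hg₀ ⟨‖v‖, norm_nonneg _, hv⟩ ⟨θ, hθ⟩ _ rfl]
      simp only [hγ, w]
      rw [smul_smul, mul_inv_cancel₀ (norm_ne_zero_iff.2 h0), one_smul]
  · intro z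
    have h1 : ‖g₀ z‖ ≤ 1 := by rw [g₀norm]; exact mem_closedBall_zero_iff.1 z.2
    rw [Prod.norm_def, max_le_iff, Real.norm_eq_abs, Real.norm_eq_abs, abs_le, abs_le] at h1
    simp only [hhalf, Set.mem_Icc]
    refine ⟨⟨?_, ?_⟩, ?_, ?_⟩ <;> linarith [h1.1.1, h1.1.2, h1.2.1, h1.2.2]
  · intro z hz
    rw [← g₀norm, Prod.norm_def, max_lt_iff, Real.norm_eq_abs, Real.norm_eq_abs, abs_lt,
      abs_lt] at hz
    simp only [hhalf, Set.mem_Ioo]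
    refine ⟨⟨?_, ?_⟩, ?_, ?_⟩ <;> linarith [hz.1.1, hz.1.2, hz.2.1, hz.2.2]
  · intro θ hθ z hz
    have := hg₀ 1 ⟨θ, hθ⟩ z (by simpa using hz)
    simp only [this, γ]
    ext <;> simp

/-! ### The double mapping cylinder as a 2-complex -/

/-- `Φ` exhibits its image as the double mapping cylinder of the maps `z ↦ z ^ m` and
`z ↦ z ^ (m + 1)` of the circle: it glues the two ends of the cylinder `I × S¹` along these maps
and identifies nothing else. -/
def IsTorusCylinder (m : ℕ) {Z : Type*} (Φ : I × Circle → Z) : Prop :=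
  ∀ p p', Φ p = Φ p' ↔ p.1 = p'.1 ∧ ((p.1 : ℝ) < 1 → p.2 ^ m = p'.2 ^ m) ∧
    (0 < (p.1 : ℝ) → p.2 ^ (m + 1) = p'.2 ^ (m + 1))

theorem length_torusWord (m : ℕ) : (torusWord (m + 1)).length = 2 * m + 3 := by
  simp [torusWord]; omega

theorem torusWord_get_cases (m : ℕ) (i : Fin (torusWord (m + 1)).length) :
    ((i : ℕ) < m ∧ (torusWord (m + 1)).get i = (.a, true)) ∨
    ((i : ℕ) = m ∧ (torusWord (m + 1)).get i = (.c, true)) ∨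
    (m + 1 ≤ (i : ℕ) ∧ (i : ℕ) < 2 * m + 2 ∧ (torusWord (m + 1)).get i = (.b, false)) ∨
    ((i : ℕ) = 2 * m + 2 ∧ (torusWord (m + 1)).get i = (.c, false)) := by
  obtain ⟨i, hi⟩ := i
  rw [length_torusWord] at hi
  simp only [torusWord, List.get_eq_getElem, List.getElem_append, List.length_append,
    List.length_replicate, List.length_singleton, List.getElem_replicate, List.getElem_singleton]
  split_ifs <;> simp <;> omega

instance : DiscreteTopology TorusVertex := ⟨rfl⟩

instance : DiscreteTopology TorusEdge := ⟨rfl⟩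

instance : Finite TorusVertex :=
  Finite.of_surjective (fun b : Bool => if b then TorusVertex.u else TorusVertex.v) (by
    rintro (_ | _)
    exacts [⟨true, rfl⟩, ⟨false, rfl⟩])

instance : Finite TorusEdge :=
  Finite.of_surjective (fun i : Fin 3 => ![TorusEdge.a, TorusEdge.b, TorusEdge.c] i) (by
    rintro (_ | _ | _)
    exacts [⟨0, rfl⟩, ⟨1, rfl⟩, ⟨2, rfl⟩])

namespace TorusComplex

/-- The disjoint union of the cells of `TorusComplex k`. -/
abbrev Cells : Type := TorusVertex ⊕ (TorusEdge × I) ⊕ Metric.closedBall (0 : ℂ) 1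

/-- The class in the complex of a point of an edge. -/
def edgeClass (k : ℕ) (e : TorusEdge) (t : I) : TorusComplex k :=
  Quot.mk _ (Sum.inr (Sum.inl (e, t)))

/-- The class in the complex of a point of the disc. -/
def discClass (k : ℕ) (z : Metric.closedBall (0 : ℂ) 1) : TorusComplex k :=
  Quot.mk _ (Sum.inr (Sum.inr z))

theorem edgeClass_zero (k : ℕ) (e : TorusEdge) :
    edgeClass k e 0 = Quot.mk _ (Sum.inl e.src) := Quot.sound (.source e)

theorem edgeClass_one (k : ℕ) (e : TorusEdge) :
    edgeClass k e 1 = Quot.mk _ (Sum.inl e.tgt) := Quot.sound (.target e)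

/-- The point of the boundary circle of the disc at angle `θ`, measured in full turns. -/
noncomputable def boundaryPoint (θ : ℝ) : Metric.closedBall (0 : ℂ) 1 :=
  ⟨turn θ, by simp [Circle.norm_coe]⟩

theorem discClass_boundaryPoint {m i : ℕ} (hi : i < 2 * m + 3) (t : I) {τ : ℝ}
    (hτ : τ = i + t) :
    discClass (m + 1) (boundaryPoint (τ / (2 * m + 3))) =
      edgeClass (m + 1) ((torusWord (m + 1)).get ⟨i, by rwa [length_torusWord]⟩).1
        (if ((torusWord (m + 1)).get ⟨i, by rwa [length_torusWord]⟩).2 then t else σ t) := by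
  refine Quot.sound (.boundary ⟨i, by rwa [length_torusWord]⟩ t _ ?_)
  have hlen : ((torusWord (m + 1)).length : ℝ) = 2 * m + 3 := by
    rw [length_torusWord]; push_cast; rfl
  simp only [boundaryPoint, turn]
  rw [hlen, hτ, mul_div_assoc]

/-- Every point of `[0, n]` lies in one of the intervals `[i, i + 1]` with `i < n`. -/
theorem exists_nat_add_unitInterval {n : ℕ} (hn : 1 ≤ n) {x : ℝ} (h₀ : 0 ≤ x) (h₁ : x ≤ n) :
    ∃ i < n, ∃ t : I, x = i + t := by
  rcases h₁.lt_or_eq with h | h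
  · have := Nat.floor_le h₀
    have h2 := Nat.lt_floor_add_one x
    exact ⟨⌊x⌋₊, (Nat.floor_lt h₀).2 h, ⟨x - ⌊x⌋₊, by linarith, by linarith⟩, by simp⟩
  · refine ⟨n - 1, by omega, 1, ?_⟩
    rw [h, Nat.cast_sub hn]; simp

section

variable {m : ℕ} {τ : ℝ}

theorem discClass_bottom (hm : 1 ≤ m) (h₀ : 0 ≤ τ) (h₁ : τ ≤ m) :
    ∃ (i : ℕ) (t : I), τ = i + t ∧
      discClass (m + 1) (boundaryPoint (τ / (2 * m + 3))) = edgeClass (m + 1) .a t := by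
  obtain ⟨i, hi, t, h⟩ := exists_nat_add_unitInterval hm h₀ h₁
  refine ⟨i, t, h, ?_⟩
  rw [discClass_boundaryPoint (i := i) (by omega) t h]
  have := torusWord_get_cases m ⟨i, by rw [length_torusWord]; omega⟩
  simp only at this
  rcases this with h | h | h | h <;> first | (exfalso; omega) | skip
  rw [h.2]; simp

theorem discClass_right (t : I) (h : τ = m + t) :
    discClass (m + 1) (boundaryPoint (τ / (2 * m + 3))) = edgeClass (m + 1) .c t := by
  rw [discClass_boundaryPoint (i := m) (by omega) t h]
  have := torusWord_get_cases m ⟨m, by rw [length_torusWord]; omega⟩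
  simp only at this
  rcases this with h | h | h | h <;> first | (exfalso; omega) | skip
  rw [h.2]; simp

theorem discClass_top (h₀ : m + 1 ≤ τ) (h₁ : τ ≤ 2 * m + 2) :
    ∃ (i : ℕ) (t : I), 2 * m + 2 - τ = i + t ∧
      discClass (m + 1) (boundaryPoint (τ / (2 * m + 3))) = edgeClass (m + 1) .b t := by
  obtain ⟨i, hi, t, h⟩ := exists_nat_add_unitInterval (n := m + 1) (x := 2 * m + 2 - τ)
    (by omega) (by linarith) (by push_cast; linarith)
  refine ⟨i, t, h, ?_⟩
  rw [discClass_boundaryPoint (i := 2 * m + 1 - i) (by omega) (σ t) (by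
    rw [Nat.cast_sub (by omega), unitInterval.coe_symm_eq]; push_cast; linarith)]
  have := torusWord_get_cases m ⟨2 * m + 1 - i, by rw [length_torusWord]; omega⟩
  simp only at this
  rcases this with h | h | h | h <;> first | (exfalso; omega) | skip
  rw [h.2.2]; simp

theorem discClass_left (t : I) (h : τ = 2 * m + 3 - t) :
    discClass (m + 1) (boundaryPoint (τ / (2 * m + 3))) = edgeClass (m + 1) .c t := by
  rw [discClass_boundaryPoint (i := 2 * m + 2) (by omega) (σ t) (by
    rw [unitInterval.coe_symm_eq]; push_cast; linarith)]
  have := torusWord_get_cases m ⟨2 * m + 2, by rw [length_torusWord]; omega⟩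
  simp only at this
  rcases this with h | h | h | h <;> first | (exfalso; omega) | skip
  rw [h.2]; simp

end

/-- An edge whose two ends coincide is a circle. -/
theorem edgeClass_eq_of_turn_eq {k : ℕ} {e : TorusEdge} (he : e.src = e.tgt) {t t' : I}
    (h : turn t = turn t') : edgeClass k e t = edgeClass k e t' := by
  obtain ⟨n, hn⟩ := turn_eq_turn_iff.1 h
  have a := t.2
  have b := t'.2
  have n1 : n ≤ 1 := by
    have : (n : ℝ) ≤ 1 := by linarith [a.2, b.1]
    exact_mod_cast this
  have n2 : -1 ≤ n := by
    have : (-1 : ℝ) ≤ n := by linarith [a.1, b.2]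
    exact_mod_cast this
  have e01 : edgeClass k e 0 = edgeClass k e 1 := by rw [edgeClass_zero, edgeClass_one, he]
  interval_cases n
  · push_cast at hn
    have e1 : t = 0 := Subtype.ext (by simp only [Set.Icc.coe_zero]; linarith [a.1, b.2])
    have e2 : t' = 1 := Subtype.ext (by simp only [Set.Icc.coe_one]; linarith [a.1, b.2])
    rw [e1, e2, e01]
  · congr 1
    exact Subtype.ext (by rw [hn]; simp)
  · push_cast at hn
    have e1 : t = 1 := Subtype.ext (by simp only [Set.Icc.coe_one]; linarith [a.2, b.1])
    have e2 : t' = 0 := Subtype.ext (by simp only [Set.Icc.coe_zero]; linarith [a.2, b.1])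
    rw [e1, e2, e01]

end TorusComplex

open TorusComplex in
/-- The image of the double mapping cylinder of `z ↦ z ^ m` and `z ↦ z ^ (m + 1)` is the 2-complex
of the word `a ^ m c b ^ (-(m + 1)) c⁻¹`: cutting the cylinder `I × S¹` along `I × {1}` gives a
square, and its four sides are `a ^ m`, `c`, `b ^ (m + 1)` and `c`. -/
theorem IsTorusCylinder.nonempty_homeomorph {m : ℕ} (hm : 1 ≤ m) {Z : Type*} [TopologicalSpace Z]
    [T2Space Z] {Φ : I × Circle → Z} (hΦ : IsTorusCylinder m Φ) (hcont : Continuous Φ) :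
    Nonempty (Set.range Φ ≃ₜ TorusComplex (m + 1)) := by
  have hM : (0 : ℝ) < 2 * m + 3 := by positivity
  have hm0 : (m : ℝ) ≠ 0 := by positivity
  have hm1 : (m : ℝ) + 1 ≠ 0 := by positivity
  obtain ⟨g, gcont, ginj, gsurj, gmem, gint, gbd⟩ := exists_disc_to_square hm
  -- The first coordinate of the square is the angle, the second one the height in the cylinder.
  let S : ℝ × ℝ → Z := fun p => Φ (Set.projIcc 0 1 zero_le_one p.2, turn p.1)
  have Scont : Continuous S := by
    have : Continuous fun p : ℝ × ℝ => Set.projIcc (0 : ℝ) 1 zero_le_one p.2 :=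
      continuous_projIcc.comp continuous_snd
    fun_prop
  let N : Cells → Z := Sum.elim (fun x => match x with | .u => S (0, 0) | .v => S (0, 1))
    (Sum.elim (fun q => match q with
      | (.a, t) => S (t / m, 0)
      | (.b, t) => S (t / (m + 1), 1)
      | (.c, t) => S (0, t)) (fun z => S (g z)))
  have Ncont : Continuous N := by
    refine continuous_of_discreteTopology.sumElim (Continuous.sumElim ?_ (Scont.comp gcont))
    rw [continuous_prod_of_discrete_left]
    rintro (_ | _ | _) <;> simp only <;> fun_prop
  have proj : ∀ {x : ℝ} (hx : x ∈ Set.Icc (0 : ℝ) 1),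
      Set.projIcc (0 : ℝ) 1 zero_le_one x = ⟨x, hx⟩ := fun hx => Set.projIcc_of_mem _ hx
  have hS : ∀ {x y x' y' : ℝ}, y ∈ Set.Icc (0 : ℝ) 1 → y' ∈ Set.Icc (0 : ℝ) 1 →
      (S (x, y) = S (x', y') ↔ y = y' ∧ (y < 1 → turn (m * x) = turn (m * x')) ∧
        (0 < y → turn ((m + 1) * x) = turn ((m + 1) * x'))) := by
    intro x y x' y' hy hy'
    simp only [S]
    rw [hΦ, proj hy, proj hy']
    simp only [Subtype.mk.injEq, turn_pow]
    push_cast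
    rfl
  have I0 : (0 : ℝ) ∈ Set.Icc (0 : ℝ) 1 := ⟨le_rfl, zero_le_one⟩
  have I1 : (1 : ℝ) ∈ Set.Icc (0 : ℝ) 1 := ⟨zero_le_one, le_rfl⟩
  have hS' : ∀ {x y x' : ℝ}, y ∈ Set.Icc (0 : ℝ) 1 → turn x = turn x' → S (x, y) = S (x', y) := by
    intro x y x' hy h
    simp only [S, h]
  have gbd' : ∀ {τ : ℝ}, 0 ≤ τ → τ ≤ 2 * m + 3 →
      g (boundaryPoint (τ / (2 * m + 3))) = squareBoundary m τ := by
    intro τ h₀ h₁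
    rw [gbd (τ / (2 * m + 3)) ⟨by positivity, (div_le_one hM).2 h₁⟩ _ rfl,
      mul_div_cancel₀ _ hM.ne']
  -- The map on the cells respects the identifications.
  have Nrel : ∀ w w', TwoComplex.Rel TorusEdge.src TorusEdge.tgt (torusWord (m + 1)) w w' →
      N w = N w' := by
    rintro _ _ (e | e | ⟨i, t, z, hz⟩)
    · rcases e with _ | _ | _ <;> simp [N, TorusEdge.src]
    · rcases e with _ | _ | _ <;> simp [N, TorusEdge.tgt]
      · rw [hS I0 I0]
        simp [hm0, -one_div]
      · rw [hS I1 I1]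
        simp [hm1, -one_div]
    · have hi : (i : ℕ) < 2 * m + 3 := i.2.trans_eq (length_torusWord m)
      have hlen : ((torusWord (m + 1)).length : ℝ) = 2 * m + 3 := by
        rw [length_torusWord]; push_cast; rfl
      have hτ : (0 : ℝ) ≤ i + t := add_nonneg (Nat.cast_nonneg _) t.2.1
      have hi' : ((i : ℕ) : ℝ) + 1 ≤ 2 * m + 3 := by exact_mod_cast hi
      have hz' : z = boundaryPoint ((i + t) / (2 * m + 3)) := by
        apply Subtype.ext
        simp only [boundaryPoint, turn]
        rw [hz, hlen, mul_div_assoc]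
      have t0 := t.2.1
      have t1 := t.2.2
      have key : N (Sum.inr (Sum.inr z)) = S (squareBoundary m (i + t)) := by
        simp only [N, Sum.elim_inr, hz', gbd' hτ (by linarith)]
      rw [key]
      rcases torusWord_get_cases m i with ⟨h, h'⟩ | ⟨h, h'⟩ | ⟨h, h₂, h'⟩ | ⟨h, h'⟩ <;>
        rw [h'] <;> simp only [N, Sum.elim_inr, Sum.elim_inl, if_true]
      · have : ((i : ℕ) : ℝ) + 1 ≤ m := by exact_mod_cast h
        rw [squareBoundary_bottom hm hτ (by linarith), hS I0 I0]
        simp [mul_div_cancel₀ _ hm0, turn_add]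
      · rw [h, squareBoundary_right hm (by linarith) (by linarith), add_sub_cancel_left]
        exact hS' t.2 (by simp)
      · have a : (m : ℝ) + 1 ≤ (i : ℕ) := by exact_mod_cast h
        have b : ((i : ℕ) : ℝ) + 1 ≤ 2 * m + 2 := by exact_mod_cast h₂
        rw [squareBoundary_top hm (by linarith) (by linarith), hS I1 I1]
        refine ⟨rfl, fun h => absurd h (lt_irrefl _), fun _ => ?_⟩
        rw [mul_div_cancel₀ _ hm1, mul_div_cancel₀ _ hm1, turn_eq_turn_iff]
        refine ⟨2 * m + 1 - i, ?_⟩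
        simp [unitInterval.coe_symm_eq]
        ring
      · rw [h]
        push_cast
        rw [squareBoundary_left hm (by linarith) (by linarith)]
        have : 2 * (m : ℝ) + 3 - (2 * m + 2 + t) = ((σ t : I) : ℝ) := by
          rw [unitInterval.coe_symm_eq]; ring
        rw [this]
  have Nmk : ∀ w w', (Quot.mk _ w : TorusComplex (m + 1)) = Quot.mk _ w' → N w = N w' :=
    fun w w' h => congrArg (Quot.lift N Nrel) h
  -- Every boundary point of the disc is identified with the expected point of an edge.
  let BD : Metric.closedBall (0 : ℂ) 1 → Prop := fun z =>
      ((g z).2 = 0 ∧ ∃ t : I, turn (m * (g z).1) = turn t ∧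
        discClass (m + 1) z = edgeClass (m + 1) .a t) ∨
      ((g z).2 = 1 ∧ ∃ t : I, turn ((m + 1) * (g z).1) = turn t ∧
        discClass (m + 1) z = edgeClass (m + 1) .b t) ∨
      ((g z).2 ∈ Set.Ioo (0 : ℝ) 1 ∧ ∃ t : I, (g z).2 = t ∧
        discClass (m + 1) z = edgeClass (m + 1) .c t)
  have bd : ∀ z : Metric.closedBall (0 : ℂ) 1, ‖(z : ℂ)‖ = 1 → BD z := by
    intro z hz
    have hc : ∀ t : I, (g z).2 = t → turn (g z).1 = 1 →
        discClass (m + 1) z = edgeClass (m + 1) .c t → BD z := by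
      intro t ht hx h
      rcases t.2.1.eq_or_lt with h0 | h0
      · left
        refine ⟨ht.trans h0.symm, 0, by rw [← turn_pow, hx]; simp, ?_⟩
        rw [h, show t = 0 from Subtype.ext h0.symm, edgeClass_zero, edgeClass_zero]
        rfl
      right
      rcases t.2.2.eq_or_lt with h1 | h1
      · left
        refine ⟨ht.trans h1, 0, ?_, ?_⟩
        · have := turn_pow (g z).1 (m + 1)
          push_cast at this
          rw [← this, hx]; simp
        rw [h, show t = 1 from Subtype.ext h1, edgeClass_one, edgeClass_zero]
        rfl
      · right
        exact ⟨ht ▸ ⟨h0, h1⟩, t, ht, h⟩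
    obtain ⟨θ, hθ, h⟩ := exists_turn_eq ⟨z, mem_sphere_zero_iff_norm.2 hz⟩
    obtain ⟨τ, rfl⟩ : ∃ τ, θ = τ / (2 * m + 3) :=
      ⟨θ * (2 * m + 3), (mul_div_cancel_right₀ _ hM.ne').symm⟩
    have h₀ : 0 ≤ τ := by
      have := mul_nonneg hθ.1 hM.le
      rwa [div_mul_cancel₀ _ hM.ne'] at this
    have h₁ : τ ≤ 2 * m + 3 := (div_le_one hM).1 hθ.2.le
    obtain rfl : z = boundaryPoint (τ / (2 * m + 3)) := Subtype.ext (congrArg Subtype.val h).symm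
    simp only [BD] at hc ⊢
    rw [gbd' h₀ h₁] at hc ⊢
    rcases squareBoundary_cases hm h₀ h₁ with
      ⟨a, b, c, -⟩ | ⟨a, b, c, d⟩ | ⟨a, b, c, d⟩ | ⟨a, b, c, d⟩
    · left
      obtain ⟨i, t, e, e'⟩ := discClass_bottom hm h₀ a
      exact ⟨c, t, by rw [b, e, turn_add]; simp, e'⟩
    · exact hc ⟨_, d⟩ rfl (by rw [b, turn_one]) (discClass_right ⟨_, d⟩ c.symm)
    · right; left
      have hx := mul_nonneg (by linarith : (0 : ℝ) ≤ m + 1) d.1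
      obtain ⟨i, t, e, e'⟩ := discClass_top a (by linarith)
      exact ⟨c, t, by rw [b, e, turn_add]; simp, e'⟩
    · exact hc ⟨_, d⟩ rfl (by rw [b, turn_zero])
        (discClass_left ⟨_, d⟩ (by simp only [c]; ring))
  have Ndisc : ∀ z z' : Metric.closedBall (0 : ℂ) 1, S (g z) = S (g z') →
      discClass (m + 1) z = discClass (m + 1) z' := by
    have interior : ∀ z z' : Metric.closedBall (0 : ℂ) 1, S (g z) = S (g z') → ‖(z : ℂ)‖ < 1 →
        z = z' := by
      intro z z' h hz
      obtain ⟨⟨a, b⟩, c, d⟩ := gint z hz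
      obtain ⟨e, e'⟩ := gmem z'
      obtain ⟨f, f₁, f₂⟩ := (hS ⟨c.le, d.le⟩ e').1 h
      have f₁ := f₁ d
      have f₂ := f₂ c
      have k : turn (g z).1 = turn (g z').1 := by
        apply eq_of_pow_eq_pow_succ (m := m) <;> rw [turn_pow, turn_pow]
        · exact f₁
        · push_cast; exact f₂
      obtain ⟨n, hn⟩ := turn_eq_turn_iff.1 k
      have n1 : n < 1 := by
        have : (n : ℝ) < 1 := by linarith [e.1]
        exact_mod_cast this
      have n2 : -1 < n := by
        have : (-1 : ℝ) < n := by linarith [e.2]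
        exact_mod_cast this
      obtain rfl : n = 0 := by omega
      exact ginj (Prod.ext (by simpa using hn) f)
    intro z z' h
    rcases (mem_closedBall_zero_iff.1 z.2).lt_or_eq with hz | hz
    · rw [interior z z' h hz]
    rcases (mem_closedBall_zero_iff.1 z'.2).lt_or_eq with hz' | hz'
    · rw [interior z' z h.symm hz']
    obtain ⟨f, f₁, f₂⟩ := (hS (gmem z).2 (gmem z').2).1 h
    rcases bd z hz with ⟨a, t, b, c⟩ | ⟨a, t, b, c⟩ | ⟨a, t, b, c⟩ <;>
    rcases bd z' hz' with ⟨a', t', b', c'⟩ | ⟨a', t', b', c'⟩ | ⟨a', t', b', c'⟩ <;>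
    rw [← f] at a' <;>
    first
    | (exfalso; linarith [a.1, a.2])
    | (exfalso; linarith [a'.1, a'.2])
    | (exfalso; linarith)
    | rw [c, c']
    · refine edgeClass_eq_of_turn_eq rfl ?_
      rw [← b, ← b', f₁ (by rw [a]; exact zero_lt_one)]
    · refine edgeClass_eq_of_turn_eq rfl ?_
      rw [← b, ← b', f₂ (by rw [a]; exact zero_lt_one)]
    · rw [show t = t' from Subtype.ext (by rw [← b, ← b', f])]
  have Nsurj : ∀ w : Cells, ∃ z, N w = S (g z) ∧
      (Quot.mk _ w : TorusComplex (m + 1)) = discClass (m + 1) z := by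
    have edges : ∀ e t, ∃ z, (edgeClass (m + 1) e t) = discClass (m + 1) z := by
      have hm' : (1 : ℝ) ≤ m := by exact_mod_cast hm
      rintro (_ | _ | _) t <;> have t0 := t.2.1 <;> have t1 := t.2.2
      · obtain ⟨i, t', e, e'⟩ := discClass_bottom hm t0 (by linarith)
        refine ⟨_, (edgeClass_eq_of_turn_eq rfl ?_).trans e'.symm⟩
        rw [e, turn_add]; simp
      · obtain ⟨i, t', e, e'⟩ := discClass_top (m := m) (τ := 2 * m + 2 - t) (by linarith)
          (by linarith)
        refine ⟨_, (edgeClass_eq_of_turn_eq rfl ?_).trans e'.symm⟩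
        rw [sub_sub_cancel] at e
        rw [e, turn_add]; simp
      · exact ⟨_, (discClass_right t rfl).symm⟩
    have main : ∀ w : Cells, ∃ z, (Quot.mk _ w : TorusComplex (m + 1)) = discClass (m + 1) z := by
      rintro ((_ | _) | ⟨e, t⟩ | z)
      · rw [show TorusVertex.u = TorusEdge.a.src from rfl, ← edgeClass_zero]
        exact edges _ _
      · rw [show TorusVertex.v = TorusEdge.b.src from rfl, ← edgeClass_zero]
        exact edges _ _
      · exact edges e t
      · exact ⟨z, rfl⟩
    intro w
    obtain ⟨z, hz⟩ := main w
    exact ⟨z, Nmk _ _ hz, hz⟩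
  let N' : Cells → Set.range Φ := fun w => ⟨N w, by
    obtain ⟨z, hz, -⟩ := Nsurj w
    exact ⟨_, hz.symm⟩⟩
  have N'cont : Continuous N' := Ncont.subtype_mk _
  have N'surj : Function.Surjective N' := by
    rintro ⟨_, ⟨y, ζ⟩, rfl⟩
    obtain ⟨x, hx, rfl⟩ := exists_turn_eq ζ
    obtain ⟨z, hz⟩ := gsurj (x, y) ⟨hx.1, hx.2.le⟩ y.2
    refine ⟨Sum.inr (Sum.inr z), Subtype.ext ?_⟩
    simp only [N', N, Sum.elim_inr, hz, S, proj y.2]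
  have hN' : Topology.IsQuotientMap N' := N'cont.isClosedMap.isQuotientMap N'cont N'surj
  refine hN'.nonempty_homeomorph_of_fibres isQuotientMap_quot_mk fun w w' => ?_
  rw [Subtype.mk.injEq]
  refine ⟨fun h => ?_, Nmk w w'⟩
  obtain ⟨z, hz, hz'⟩ := Nsurj w
  obtain ⟨y, hy, hy'⟩ := Nsurj w'
  rw [hz', hy']
  exact Ndisc z y (hz ▸ hy ▸ h)

/-! ### The torus knot complement -/

/-- A deformation retract of a subspace `S`, given as a subset of the ambient space. -/
theorem IsDeformationRetract.nonempty_homotopyEquiv_of_subset {Y : Type*} [TopologicalSpace Y]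
    {B S : Set Y} (hBS : B ⊆ S) (h : IsDeformationRetract ((↑) ⁻¹' B : Set S)) :
    Nonempty (ContinuousMap.HomotopyEquiv B S) := by
  obtain ⟨e⟩ := h.nonempty_homotopyEquiv
  let f : B ≃ₜ ((↑) ⁻¹' B : Set S) :=
    { toFun := fun b => ⟨⟨b, hBS b.2⟩, b.2⟩
      invFun := fun a => ⟨a.1, a.2⟩
      left_inv := fun _ => rfl
      right_inv := fun _ => rfl
      continuous_toFun := by fun_prop
      continuous_invFun := by fun_prop }
  exact ⟨f.toHomotopyEquiv.trans e⟩

/-- The parametrization of `S³` as the join of the circles `{w = 0}` and `{z = 0}`. -/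
noncomputable def joinPoint (p : I × Circle × Circle) : ThreeSphere :=
  ⟨!₂[(Real.sqrt (1 - p.1) : ℂ) * p.2.1, (Real.sqrt p.1 : ℂ) * p.2.2], by
    have h0 := p.1.2.1
    have h1 : 0 ≤ 1 - (p.1 : ℝ) := by linarith [p.1.2.2]
    rw [mem_sphere_zero_iff_norm, EuclideanSpace.norm_eq]
    simp [Circle.norm_coe, abs_of_nonneg, Real.sqrt_nonneg, Real.sq_sqrt h0, Real.sq_sqrt h1]⟩

theorem continuous_joinPoint : Continuous joinPoint := by
  refine Continuous.subtype_mk ?_ _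
  refine (PiLp.continuous_toLp 2 _).comp (continuous_pi fun i => ?_)
  have a : Continuous fun p : I × Circle × Circle => (Real.sqrt (1 - p.1) : ℂ) :=
    Complex.continuous_ofReal.comp (by fun_prop)
  have b : Continuous fun p : I × Circle × Circle => (Real.sqrt p.1 : ℂ) :=
    Complex.continuous_ofReal.comp (by fun_prop)
  fin_cases i
  · exact a.mul (continuous_subtype_val.comp continuous_snd.fst)
  · exact b.mul (continuous_subtype_val.comp continuous_snd.snd)

theorem joinPoint_eq_iff {p p' : I × Circle × Circle} : joinPoint p = joinPoint p' ↔
    p.1 = p'.1 ∧ ((p.1 : ℝ) < 1 → p.2.1 = p'.2.1) ∧ (0 < (p.1 : ℝ) → p.2.2 = p'.2.2) := by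
  obtain ⟨r, a, b⟩ := p
  obtain ⟨r', a', b'⟩ := p'
  have h0 := r.2.1
  have h0' := r'.2.1
  simp only
  constructor
  · intro h
    have e0 : (Real.sqrt (1 - r) : ℂ) * a = (Real.sqrt (1 - r') : ℂ) * a' :=
      congrArg (fun x : ThreeSphere => x.1 0) h
    have e1 : (Real.sqrt r : ℂ) * b = (Real.sqrt r' : ℂ) * b' :=
      congrArg (fun x : ThreeSphere => x.1 1) h
    have e : r = r' := by
      have := congrArg norm e1
      simp only [norm_mul, Circle.norm_coe, mul_one, Complex.norm_real, Real.norm_eq_abs,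
        abs_of_nonneg (Real.sqrt_nonneg _)] at this
      exact Subtype.ext ((Real.sqrt_inj h0 h0').1 this)
    subst e
    refine ⟨rfl, fun h => Circle.ext (mul_left_cancel₀ ?_ e0),
      fun h => Circle.ext (mul_left_cancel₀ ?_ e1)⟩
    · exact Complex.ofReal_ne_zero.2 (Real.sqrt_pos.2 (by linarith)).ne'
    · exact Complex.ofReal_ne_zero.2 (Real.sqrt_pos.2 h).ne'
  · rintro ⟨rfl, ha, hb⟩
    have e0 : (Real.sqrt (1 - r) : ℂ) * a = (Real.sqrt (1 - r) : ℂ) * a' := by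
      rcases r.2.2.lt_or_eq with h | h
      · rw [ha h]
      · simp [h]
    have e1 : (Real.sqrt r : ℂ) * b = (Real.sqrt r : ℂ) * b' := by
      rcases h0.lt_or_eq with h | h
      · rw [hb h]
      · simp [← h]
    simp only [joinPoint, e0, e1]

theorem joinPoint_surjective : Function.Surjective joinPoint := by
  rintro ⟨x, hx⟩
  have hx' : ‖x 0‖ ^ 2 + ‖x 1‖ ^ 2 = 1 := by
    have := EuclideanSpace.norm_sq_eq x
    rw [mem_sphere_zero_iff_norm.1 hx, Fin.sum_univ_two] at this
    linarith
  have h1 : ‖x 1‖ ^ 2 ≤ 1 := by nlinarith [sq_nonneg ‖x 0‖]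
  refine ⟨(⟨‖x 1‖ ^ 2, sq_nonneg _, h1⟩, Circle.exp (x 0).arg, Circle.exp (x 1).arg),
    Subtype.ext ?_⟩
  ext i
  have e : 1 - ‖x 1‖ ^ 2 = ‖x 0‖ ^ 2 := by linarith
  fin_cases i
  · simp [joinPoint, e, Circle.coe_exp]
  · simp [joinPoint, Circle.coe_exp]

theorem mem_torusKnot_iff {p q : ℕ} {x : ThreeSphere} : x ∈ torusKnot p q ↔
    ∃ z : Circle, x = joinPoint (⟨1 / 2, by norm_num, by norm_num⟩, z ^ p, z ^ q) := by
  refine exists_congr fun z => ?_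
  have e : (1 : ℝ) - 1 / 2 = 1 / 2 := by norm_num
  have e' : ((Real.sqrt (1 / 2) : ℝ) : ℂ) = 1 / (Real.sqrt 2 : ℂ) := by
    rw [Real.sqrt_div zero_le_one]; simp
  constructor
  · rintro ⟨h0, h1⟩
    apply Subtype.ext
    ext i
    fin_cases i
    · simp only [joinPoint, e, e', Circle.coe_pow]
      simp [h0]; ring
    · simp only [joinPoint, e', Circle.coe_pow]
      simp [h1]; ring
  · rintro rfl
    simp only [joinPoint, e, e', Circle.coe_pow]
    constructor <;> simp <;> ring

/-- A cylinder in `S³` that winds around the two core circles `m` and `m + 1` times. The signs turn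
the phase of `z ^ (m + 1) / w ^ m` by a half turn, which keeps the cylinder off the knot. -/
noncomputable def spineMap (m : ℕ) (p : I × Circle) : ThreeSphere :=
  joinPoint (p.1, -p.2 ^ m, -p.2 ^ (m + 1))

theorem continuous_neg_circle : Continuous fun z : Circle => -z := by
  refine Continuous.subtype_mk ?_ _
  exact continuous_neg.comp continuous_subtype_val

theorem continuous_spineMap (m : ℕ) : Continuous (spineMap m) := by
  have := continuous_neg_circle
  exact continuous_joinPoint.comp (by fun_prop)

theorem isTorusCylinder_spineMap (m : ℕ) : IsTorusCylinder m (spineMap m) := by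
  intro p p'
  simp [spineMap, joinPoint_eq_iff]

/-- Coordinates on `S³` adapted to the `(m, m + 1)`-torus knot: a square, the unit ball of the
sup norm on `ℝ²`, times a circle. The first coordinate of the square is `|z|² - |w|²`, the second
one is the phase of `z ^ (m + 1) / w ^ m`, in half turns. The centre of the square yields the knot,
and its boundary yields the image of `spineMap`. -/
noncomputable def squareCoord (m : ℕ) (p : Metric.closedBall (0 : ℝ × ℝ) 1 × Circle) :
    ThreeSphere :=
  joinPoint (Set.projIcc 0 1 zero_le_one ((1 - (p.1 : ℝ × ℝ).1) / 2),
    p.2 ^ m * turn ((p.1 : ℝ × ℝ).2 / 2), p.2 ^ (m + 1) * turn ((p.1 : ℝ × ℝ).2 / 2))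

theorem continuous_squareCoord (m : ℕ) : Continuous (squareCoord m) := by
  have : Continuous fun p : Metric.closedBall (0 : ℝ × ℝ) 1 × Circle =>
      Set.projIcc (0 : ℝ) 1 zero_le_one ((1 - (p.1 : ℝ × ℝ).1) / 2) :=
    continuous_projIcc.comp (by fun_prop)
  exact continuous_joinPoint.comp (by fun_prop)

theorem abs_le_one_of_mem_closedBall (v : Metric.closedBall (0 : ℝ × ℝ) 1) :
    (-1 ≤ (v : ℝ × ℝ).1 ∧ (v : ℝ × ℝ).1 ≤ 1) ∧ (-1 ≤ (v : ℝ × ℝ).2 ∧ (v : ℝ × ℝ).2 ≤ 1) := by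
  have := mem_closedBall_zero_iff.1 v.2
  rw [Prod.norm_def, max_le_iff, Real.norm_eq_abs, Real.norm_eq_abs, abs_le, abs_le] at this
  exact this

theorem norm_eq_one_of_abs_eq_one {v : ℝ × ℝ} (hv : ‖v‖ ≤ 1) (h : |v.1| = 1 ∨ |v.2| = 1) :
    ‖v‖ = 1 := by
  refine le_antisymm hv ?_
  rw [Prod.norm_def, Real.norm_eq_abs, Real.norm_eq_abs]
  rcases h with h | h
  · exact h ▸ le_max_left _ _
  · exact h ▸ le_max_right _ _

/-- The coordinates of a point are unique unless they lie over the boundary of the square. -/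
theorem squareCoord_fibre {m : ℕ} {p p' : Metric.closedBall (0 : ℝ × ℝ) 1 × Circle}
    (h : squareCoord m p = squareCoord m p') :
    p = p' ∨ (‖(p.1 : ℝ × ℝ)‖ = 1 ∧ ‖(p'.1 : ℝ × ℝ)‖ = 1) := by
  obtain ⟨v, z⟩ := p
  obtain ⟨v', z'⟩ := p'
  have hv := mem_closedBall_zero_iff.1 v.2
  have hv' := mem_closedBall_zero_iff.1 v'.2
  obtain ⟨⟨a, b⟩, c, d⟩ := abs_le_one_of_mem_closedBall v
  obtain ⟨⟨a', b'⟩, c', d'⟩ := abs_le_one_of_mem_closedBall v'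
  simp only [squareCoord, joinPoint_eq_iff] at h
  rw [Set.projIcc_of_mem _ ⟨by linarith, by linarith⟩,
    Set.projIcc_of_mem _ ⟨by linarith, by linarith⟩] at h
  obtain ⟨h, h₁, h₂⟩ := h
  have hx : (v : ℝ × ℝ).1 = (v' : ℝ × ℝ).1 := by
    have := congrArg Subtype.val h
    simp only at this
    linarith
  rcases a.lt_or_eq with a | a
  swap
  · exact Or.inr ⟨norm_eq_one_of_abs_eq_one hv (by simp [← a]),
      norm_eq_one_of_abs_eq_one hv' (by simp [← hx, ← a])⟩
  rcases b.lt_or_eq with b | b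
  swap
  · exact Or.inr ⟨norm_eq_one_of_abs_eq_one hv (by simp [b]),
      norm_eq_one_of_abs_eq_one hv' (by simp [← hx, b])⟩
  have h₁ := h₁ (by linarith)
  have h₂ := h₂ (by linarith)
  have hz : z = z' := by
    rw [pow_succ, pow_succ, mul_right_comm, mul_right_comm (z' ^ m), h₁] at h₂
    exact mul_left_cancel h₂
  subst hz
  obtain ⟨n, hn⟩ := turn_eq_turn_iff.1 (mul_left_cancel h₁)
  have n1 : n ≤ 1 := by
    have : (n : ℝ) ≤ 1 := by linarith
    exact_mod_cast this
  have n2 : -1 ≤ n := by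
    have : (-1 : ℝ) ≤ n := by linarith
    exact_mod_cast this
  interval_cases n <;> push_cast at hn
  · have e : (v : ℝ × ℝ).2 = -1 := by linarith
    have e' : (v' : ℝ × ℝ).2 = 1 := by linarith
    exact Or.inr ⟨norm_eq_one_of_abs_eq_one hv (by simp [e]),
      norm_eq_one_of_abs_eq_one hv' (by simp [e'])⟩
  · exact Or.inl (Prod.ext (Subtype.ext (Prod.ext hx (by simpa using hn))) rfl)
  · have e : (v : ℝ × ℝ).2 = 1 := by linarith
    have e' : (v' : ℝ × ℝ).2 = -1 := by linarith
    exact Or.inr ⟨norm_eq_one_of_abs_eq_one hv (by simp [e]),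
      norm_eq_one_of_abs_eq_one hv' (by simp [e'])⟩

theorem squareCoord_surjective (m : ℕ) : Function.Surjective (squareCoord m) := by
  intro x
  obtain ⟨⟨r, a, b⟩, rfl⟩ := joinPoint_surjective x
  have r0 := r.2.1
  have r1 := r.2.2
  obtain ⟨κ, hκ, hκ'⟩ : ∃ κ ∈ Set.Icc (-1 : ℝ) 1, turn (κ / 2) = a / (b / a) ^ m := by
    obtain ⟨κ, hκ, h⟩ := exists_turn_eq (a / (b / a) ^ m)
    rcases le_total κ (1 / 2) with h2 | h2
    · exact ⟨2 * κ, ⟨by linarith [hκ.1], by linarith⟩, by rw [← h]; ring_nf⟩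
    · refine ⟨2 * κ - 2, ⟨by linarith, by linarith [hκ.2]⟩, ?_⟩
      rw [← h, turn_eq_turn_iff]
      exact ⟨-1, by push_cast; ring⟩
  refine ⟨(⟨(1 - 2 * r, κ), ?_⟩, b / a), ?_⟩
  · rw [mem_closedBall_zero_iff, Prod.norm_def, max_le_iff, Real.norm_eq_abs, Real.norm_eq_abs,
      abs_le, abs_le]
    exact ⟨⟨by linarith, by linarith⟩, hκ⟩
  · have e : Set.projIcc (0 : ℝ) 1 zero_le_one ((1 - (1 - 2 * (r : ℝ))) / 2) = r := by
      rw [Set.projIcc_of_mem _ ⟨by linarith, by linarith⟩]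
      exact Subtype.ext (by ring)
    simp only [squareCoord, e, hκ']
    rw [pow_succ, mul_div_cancel, mul_right_comm, mul_div_cancel, mul_div_cancel]

theorem squareCoord_zero_mem {m : ℕ} {p : Metric.closedBall (0 : ℝ × ℝ) 1 × Circle}
    (h : (p.1 : ℝ × ℝ) = 0) : squareCoord m p ∈ torusKnot m (m + 1) := by
  refine mem_torusKnot_iff.2 ⟨p.2, ?_⟩
  simp only [squareCoord, h]
  rw [Set.projIcc_of_mem _ (by norm_num)]
  simp

/-- The centre of the square is exactly the knot. -/
theorem squareCoord_mem_torusKnot_iff {m : ℕ} {p : Metric.closedBall (0 : ℝ × ℝ) 1 × Circle} :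
    squareCoord m p ∈ torusKnot m (m + 1) ↔ (p.1 : ℝ × ℝ) = 0 := by
  refine ⟨fun h => ?_, squareCoord_zero_mem⟩
  obtain ⟨z, hz⟩ := mem_torusKnot_iff.1 h
  have h0 : squareCoord m (⟨0, by simp⟩, z) = squareCoord m p := by
    rw [hz]
    simp only [squareCoord]
    rw [Set.projIcc_of_mem _ (by norm_num)]
    simp
  rcases squareCoord_fibre h0 with e | ⟨e, -⟩
  · rw [← e]
  · simp at e

theorem range_spineMap {m : ℕ} (hm : m ≠ 0) :
    Set.range (spineMap m) = squareCoord m '' {p | ‖(p.1 : ℝ × ℝ)‖ = 1} := by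
  apply Set.Subset.antisymm
  · rintro _ ⟨⟨r, z⟩, rfl⟩
    have r0 := r.2.1
    have r1 := r.2.2
    have hv : ‖((1 - 2 * r, 1) : ℝ × ℝ)‖ ≤ 1 := by
      rw [Prod.norm_def, max_le_iff, Real.norm_eq_abs, Real.norm_eq_abs, abs_le, abs_le]
      exact ⟨⟨by linarith, by linarith⟩, by norm_num, le_rfl⟩
    refine ⟨(⟨(1 - 2 * r, 1), mem_closedBall_zero_iff.2 hv⟩, z),
      norm_eq_one_of_abs_eq_one hv (by simp), ?_⟩
    have e : Set.projIcc (0 : ℝ) 1 zero_le_one ((1 - (1 - 2 * (r : ℝ))) / 2) = r := by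
      rw [Set.projIcc_of_mem _ ⟨by linarith, by linarith⟩]
      exact Subtype.ext (by ring)
    simp only [squareCoord, e, turn_half, spineMap, mul_neg, mul_one]
  · rintro _ ⟨⟨v, z⟩, hv, rfl⟩
    have hv : ‖(v : ℝ × ℝ)‖ = 1 := hv
    obtain ⟨⟨a, b⟩, c, d⟩ := abs_le_one_of_mem_closedBall v
    rw [Prod.norm_def, Real.norm_eq_abs, Real.norm_eq_abs] at hv
    have hI : (1 - (v : ℝ × ℝ).1) / 2 ∈ Set.Icc (0 : ℝ) 1 := ⟨by linarith, by linarith⟩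
    simp only [squareCoord]
    rw [Set.projIcc_of_mem _ hI]
    rcases max_choice |(v : ℝ × ℝ).1| |(v : ℝ × ℝ).2| with h | h <;> rw [h] at hv
    · rcases eq_or_eq_neg_of_abs_eq hv with e | e
      · obtain ⟨w, hw⟩ := exists_pow_eq hm (-(z ^ m * turn ((v : ℝ × ℝ).2 / 2)))
        refine ⟨(⟨_, hI⟩, w), ?_⟩
        simp [spineMap, joinPoint_eq_iff, hw, e]
      · obtain ⟨w, hw⟩ := exists_pow_eq m.succ_ne_zero (-(z ^ (m + 1) * turn ((v : ℝ × ℝ).2 / 2)))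
        refine ⟨(⟨_, hI⟩, w), ?_⟩
        simp [spineMap, joinPoint_eq_iff, hw, e]
    · have : turn ((v : ℝ × ℝ).2 / 2) = -1 := by
        rcases eq_or_eq_neg_of_abs_eq hv with e | e <;> rw [e]
        exacts [turn_half, turn_neg_half]
      exact ⟨(⟨_, hI⟩, z), by simp [spineMap, this]⟩

theorem range_spineMap_subset {m : ℕ} (hm : m ≠ 0) :
    Set.range (spineMap m) ⊆ (torusKnot m (m + 1))ᶜ := by
  rw [range_spineMap hm]
  rintro _ ⟨p, hp, rfl⟩ h
  rw [squareCoord_mem_torusKnot_iff] at h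
  simp [h] at hp

/-- Pushing the square radially away from its centre retracts the knot complement. -/
theorem isDeformationRetract_spine {m : ℕ} (hm : m ≠ 0) :
    IsDeformationRetract ((↑) ⁻¹' Set.range (spineMap m) :
      Set ((torusKnot m (m + 1))ᶜ : Set ThreeSphere)) := by
  let K := torusKnot m (m + 1)
  let X := squareCoord m ⁻¹' Kᶜ
  have hX : ∀ p : X, (p.1.1 : ℝ × ℝ) ≠ 0 := fun p h => p.2 (squareCoord_zero_mem h)
  let c : I × X → ℝ := fun q => (1 - q.1) + q.1 / ‖(q.2.1.1 : ℝ × ℝ)‖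
  have hc : ∀ q, 0 < c q := by
    intro q
    have a := norm_pos_iff.2 (hX q.2)
    have b := q.1.2.1
    rcases q.1.2.2.lt_or_eq with h | h
    · have : 0 ≤ (q.1 : ℝ) / ‖(q.2.1.1 : ℝ × ℝ)‖ := by positivity
      simp only [c]; linarith
    · simp only [c, h]; simpa using hX q.2
  have hcn : ∀ q, ‖c q • (q.2.1.1 : ℝ × ℝ)‖ = (1 - q.1) * ‖(q.2.1.1 : ℝ × ℝ)‖ + q.1 := by
    intro q
    have a := norm_pos_iff.2 (hX q.2)
    rw [norm_smul, Real.norm_of_nonneg (hc q).le]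
    simp only [c]
    field_simp
  let g : I × X → Metric.closedBall (0 : ℝ × ℝ) 1 × Circle := fun q =>
    (⟨c q • (q.2.1.1 : ℝ × ℝ), by
      rw [mem_closedBall_zero_iff, hcn]
      have := mem_closedBall_zero_iff.1 q.2.1.1.2
      nlinarith [q.1.2.1, q.1.2.2]⟩, q.2.1.2)
  have ccont : Continuous c := by
    have : Continuous fun q : I × X => (q.1 : ℝ) / ‖(q.2.1.1 : ℝ × ℝ)‖ :=
      Continuous.div (by fun_prop) (by fun_prop) fun q => norm_ne_zero_iff.2 (hX q.2)
    fun_prop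
  have gcont : Continuous g := by fun_prop
  have hgK : ∀ q, squareCoord m (g q) ∈ Kᶜ := by
    intro q h
    rw [squareCoord_mem_torusKnot_iff] at h
    exact smul_ne_zero (hc q).ne' (hX q.2) h
  have hone : ∀ u (p : X), ‖(p.1.1 : ℝ × ℝ)‖ = 1 → g (u, p) = p := by
    intro u p hp
    refine Prod.ext (Subtype.ext ?_) rfl
    simp [g, c, hp]
  have hfib : ∀ u (p p' : X), squareCoord m p = squareCoord m p' →
      squareCoord m (g (u, p)) = squareCoord m (g (u, p')) := by
    intro u p p' h
    rcases squareCoord_fibre h with e | ⟨e, e'⟩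
    · rw [Subtype.ext e]
    · rw [hone u p e, hone u p' e', h]
  refine IsDeformationRetract.of_isProperMap
    ((continuous_squareCoord m).isProperMap.restrictPreimage Kᶜ)
    (Set.restrictPreimage_surjective _ (squareCoord_surjective m)) _
    (h := fun q => ⟨squareCoord m (g q), hgK q⟩)
    (((continuous_squareCoord m).comp gcont).subtype_mk _) ?_ ?_ ?_ ?_
  · intro p
    apply Subtype.ext
    simp [g, c]
  · intro p
    rw [Set.mem_preimage, range_spineMap hm]
    refine ⟨_, ?_, rfl⟩
    have := hcn (1, p)
    simpa using this
  · intro u p hp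
    rw [Set.mem_preimage, range_spineMap hm] at hp
    obtain ⟨p', hp', e⟩ := hp
    have e : squareCoord m p' = squareCoord m p := e
    let p'' : X := ⟨p', by rw [Set.mem_preimage, e]; exact p.2⟩
    apply Subtype.ext
    change squareCoord m (g (u, p)) = squareCoord m p
    rw [hfib u p p'' e.symm, hone u p'' hp', e]
  · intro u p p' h
    exact Subtype.ext (hfib u p p' (congrArg Subtype.val h))

/-! ### Finite subsets of the circle and their gaps -/

namespace FiniteSubsetSpace

theorem continuous_ofTuple {k : ℕ} [NeZero k] {X : Type*} [TopologicalSpace X] :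
    Continuous (ofTuple : (Fin k → X) → FiniteSubsetSpace k X) :=
  continuous_coinduced_rng

theorem ofTuple_surjective {k : ℕ} [NeZero k] {X : Type*} :
    Function.Surjective (ofTuple : (Fin k → X) → FiniteSubsetSpace k X) := by
  rintro ⟨S, hne, hfin, hcard⟩
  have := hfin.to_subtype
  have := hne.to_subtype
  have := Fintype.ofFinite S
  obtain ⟨e⟩ : Nonempty (S ↪ Fin k) := Function.Embedding.nonempty_of_card_le (by
    rw [← Nat.card_eq_fintype_card, Nat.card_coe_set_eq]
    simpa using hcard)
  refine ⟨fun i => (Function.invFun e i : S), Subtype.ext ?_⟩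
  have hs := Function.invFun_surjective e.injective
  ext x
  constructor
  · rintro ⟨i, rfl⟩
    exact (Function.invFun e i).2
  · intro hx
    obtain ⟨i, hi⟩ := hs ⟨x, hx⟩
    exact ⟨i, congrArg Subtype.val hi⟩

/-- Finite subsets are separated by their distance functions, which vary continuously. -/
instance {k : ℕ} [NeZero k] {X : Type*} [MetricSpace X] : T2Space (FiniteSubsetSpace k X) := by
  let d : FiniteSubsetSpace k X → X → ℝ := fun S p => Metric.infDist p S.1
  have hd : Continuous d := by
    refine continuous_pi fun p => continuous_coinduced_dom.2 ?_
    have : (fun S : FiniteSubsetSpace k X => d S p) ∘ ofTuple = fun x : Fin k → X =>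
        Finset.univ.inf' Finset.univ_nonempty fun j => dist p (x j) := by
      funext x
      rw [Finset.inf'_univ_eq_ciInf]
      simp only [Function.comp, d, ofTuple, Metric.infDist_eq_iInf]
      exact iInf_range' (fun y => dist p y) x
    rw [this]
    exact Continuous.finset_inf'_apply _ fun j _ => by fun_prop
  refine T2Space.of_injective_continuous (f := d) (fun S S' h => Subtype.ext ?_) hd
  have key : ∀ S : FiniteSubsetSpace k X, ∀ p, p ∈ S.1 ↔ d S p = 0 := fun S p => by
    rw [← S.2.2.1.isClosed.mem_iff_infDist_zero S.2.1]
  ext p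
  rw [key, key, h]

end FiniteSubsetSpace

theorem mem_codimTwoComplement_iff {k : ℕ} {S : FiniteSubsetSpace k Circle} :
    S ∈ codimTwoComplement k ↔ k - 2 < S.1.ncard := by
  rw [codimTwoComplement, Set.mem_compl_iff, ← not_le, not_iff_not]
  constructor
  · rintro ⟨T, rfl⟩
    exact T.2.2.2
  · exact fun h => ⟨⟨S.1, S.2.1, S.2.2.1, h⟩, rfl⟩

section Gaps

variable {m : ℕ}

/-- The point with given barycentric coordinates with respect to the vertices `simplexVertex`.
The `i`-th coordinate is the length of a gap of the corresponding subset of the circle. -/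
noncomputable def fromGaps (m : ℕ) : (Fin (m + 1) → ℝ) →ₗ[ℝ] (Fin (m + 1) → ℝ) :=
  Fintype.linearCombination ℝ (simplexVertex (m + 1))

theorem fromGaps_apply (s : Fin (m + 1) → ℝ) (j : Fin (m + 1)) :
    fromGaps m s j = ∑ i, s i * if m + 1 ≤ (i : ℕ) + j then 1 else 0 := by
  simp [fromGaps, Fintype.linearCombination_apply, simplexVertex]

theorem fromGaps_zero (s : Fin (m + 1) → ℝ) : fromGaps m s 0 = 0 := by
  rw [fromGaps_apply]
  refine Finset.sum_eq_zero fun i _ => ?_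
  rw [if_neg (by simp; omega), mul_zero]

theorem fromGaps_succ (s : Fin (m + 1) → ℝ) (j : Fin m) :
    fromGaps m s j.succ = fromGaps m s j.castSucc + s j.castSucc.rev := by
  rw [fromGaps_apply, fromGaps_apply, ← sub_eq_iff_eq_add', ← Finset.sum_sub_distrib,
    Finset.sum_eq_single j.castSucc.rev]
  · rw [if_pos (by simp [Fin.val_rev]; omega), if_neg (by simp [Fin.val_rev])]
    simp
  · intro i _ hi
    have : (i : ℕ) ≠ m - j := fun h => hi (Fin.ext (by simp [Fin.val_rev, h]))
    rw [← mul_sub]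
    have : (m + 1 ≤ (i : ℕ) + j.succ ↔ m + 1 ≤ (i : ℕ) + j.castSucc) := by
      simp; omega
    simp only [this, sub_self, mul_zero]
  · simp

theorem fromGaps_last (s : Fin (m + 1) → ℝ) :
    fromGaps m s (Fin.last m) = ∑ i, s i - s 0 := by
  rw [fromGaps_apply, Fin.sum_univ_succ, Fin.sum_univ_succ]
  rw [if_neg (by simp), mul_zero, zero_add, add_sub_cancel_left]
  refine Finset.sum_congr rfl fun i _ => ?_
  rw [if_pos (by simp), mul_one]

/-- The points of `[0, 1]` that cut the circle `ℝ / ℤ` into arcs of lengths `s i`, where the arc of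
length `s 0` contains `0` and is divided by it in the ratio `t : 1 - t`. Starting from `0`, the
other arcs follow in the order `s m, s (m - 1), …, s 1`. -/
noncomputable def gapPos (s : Fin (m + 1) → ℝ) (t : ℝ) (j : Fin (m + 1)) : ℝ :=
  fromGaps m s j + s 0 * t

/-- The subset of the circle with gaps `s`, positioned as in `gapPos`. -/
noncomputable def gapSet (s : Fin (m + 1) → ℝ) (t : ℝ) : FiniteSubsetSpace (m + 1) Circle :=
  FiniteSubsetSpace.ofTuple fun j => turn (gapPos s t j)

theorem gapSet_val (s : Fin (m + 1) → ℝ) (t : ℝ) :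
    (gapSet s t).1 = Set.range fun j => turn (gapPos s t j) := rfl

theorem simplexMap_fromGaps {s : Fin (m + 1) → ℝ} (hs : ∑ i, s i = 1) (t : ℝ) [NeZero (m + 1)] :
    simplexMap (m + 1) (fromGaps m s, t) = gapSet s t := by
  have h : fromGaps m s ⟨m + 1 - 1, Nat.sub_one_lt (NeZero.ne _)⟩ = 1 - s 0 := by
    rw [← hs, ← fromGaps_last]; rfl
  unfold simplexMap gapSet
  congr 1
  funext j
  simp only [h, sub_sub_cancel]
  rfl

theorem gapPos_zero (s : Fin (m + 1) → ℝ) (t : ℝ) : gapPos s t 0 = s 0 * t := by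
  rw [gapPos, fromGaps_zero, zero_add]

theorem gapPos_succ (s : Fin (m + 1) → ℝ) (t : ℝ) (j : Fin m) :
    gapPos s t j.succ = gapPos s t j.castSucc + s j.castSucc.rev := by
  rw [gapPos, gapPos, fromGaps_succ]; ring

theorem gapPos_last (s : Fin (m + 1) → ℝ) (t : ℝ) :
    gapPos s t (Fin.last m) = ∑ i, s i - s 0 * (1 - t) := by
  rw [gapPos, fromGaps_last]; ring

theorem Continuous.gapSet {X : Type*} [TopologicalSpace X] {s : X → Fin (m + 1) → ℝ} {t : X → ℝ}
    (hs : Continuous s) (ht : Continuous t) : Continuous fun x => gapSet (s x) (t x) := by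
  have h : Continuous (fromGaps m) := (fromGaps m).continuous_of_finiteDimensional
  refine FiniteSubsetSpace.continuous_ofTuple.comp (continuous_pi fun j => ?_)
  have h1 : Continuous fun x => fromGaps m (s x) j := (continuous_apply j).comp (h.comp hs)
  have h2 : Continuous fun x => s x 0 := (continuous_apply 0).comp hs
  exact continuous_turn.comp (h1.add (h2.mul ht))

/-- Passing from one point to the cyclically next one crosses a single gap. -/
theorem turn_gapPos_add_one {s : Fin (m + 1) → ℝ} (hs : ∑ i, s i = 1) (t : ℝ)
    (j : Fin (m + 1)) :
    turn (gapPos s t (j + 1)) = turn (gapPos s t j) * turn (s j.rev) := by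
  rw [← turn_add]
  induction j using Fin.lastCases with
  | last =>
    rw [Fin.last_add_one, Fin.rev_last, gapPos_zero, gapPos_last, hs, turn_eq_turn_iff]
    exact ⟨-1, by push_cast; ring⟩
  | cast j => rw [Fin.coeSucc_eq_succ, gapPos_succ]

section

variable {s : Fin (m + 1) → ℝ} {t : ℝ}

theorem monotone_gapPos (hs : ∀ i, 0 ≤ s i) : Monotone (gapPos s t) := by
  rw [Fin.monotone_iff_le_succ]
  intro j
  rw [gapPos_succ]
  linarith [hs j.castSucc.rev]

theorem gapPos_mem_Icc (hs : s ∈ stdSimplex ℝ (Fin (m + 1))) (ht : t ∈ Set.Icc (0 : ℝ) 1)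
    (j : Fin (m + 1)) : gapPos s t j ∈ Set.Icc (0 : ℝ) 1 := by
  have h0 := monotone_gapPos (t := t) hs.1 (Fin.zero_le j)
  have h1 := monotone_gapPos (t := t) hs.1 (Fin.le_last j)
  rw [gapPos_zero] at h0
  rw [gapPos_last, hs.2] at h1
  have a := mul_nonneg (hs.1 0) ht.1
  have b := mul_nonneg (hs.1 0) (sub_nonneg.2 ht.2)
  exact ⟨by linarith, by linarith⟩

theorem gapPos_last_le (hs : s ∈ stdSimplex ℝ (Fin (m + 1))) :
    gapPos s t (Fin.last m) ≤ gapPos s t 0 + 1 := by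
  rw [gapPos_last, gapPos_zero, hs.2]
  linarith [hs.1 0]

end

/-! ### Gap lengths as a function of the subset -/

/-- The length of the complementary arc of `S` that contains the point at angle `y`, when `S` is
finite and nonempty and does not contain that point. -/
noncomputable def gapLength (S : Set Circle) (y : ℝ) : ℝ :=
  sInf {x | y < x ∧ turn x ∈ S} - sSup {x | x < y ∧ turn x ∈ S}

theorem gapLength_eq {S : Set Circle} {l r y : ℝ} (hl : turn l ∈ S) (hr : turn r ∈ S)
    (h : ∀ x ∈ Set.Ioo l r, turn x ∉ S) (hy : y ∈ Set.Ioo l r) : gapLength S y = r - l := by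
  have h₁ : IsLeast {x | y < x ∧ turn x ∈ S} r :=
    ⟨⟨hy.2, hr⟩, fun x hx => not_lt.1 fun hxr => h x ⟨hy.1.trans hx.1, hxr⟩ hx.2⟩
  have h₂ : IsGreatest {x | x < y ∧ turn x ∈ S} l :=
    ⟨⟨hy.1, hl⟩, fun x hx => not_lt.1 fun hxl => h x ⟨hxl, hx.1.trans hy.2⟩ hx.2⟩
  rw [gapLength, h₁.csInf_eq, h₂.csSup_eq]

theorem turn_notMem_range_of_mem_Ioo {x : Fin (m + 1) → ℝ} (hx : Monotone x)
    (hx' : x (Fin.last m) ≤ x 0 + 1) {j : Fin m} {y : ℝ}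
    (hy : y ∈ Set.Ioo (x j.castSucc) (x j.succ)) : turn y ∉ Set.range fun i => turn (x i) := by
  rintro ⟨i, hi⟩
  obtain ⟨n, hn⟩ := turn_eq_turn_iff.1 hi
  have a := hx (Fin.zero_le i)
  have b := hx (Fin.le_last i)
  have c := hx (Fin.zero_le j.castSucc)
  have d := hx (Fin.le_last j.succ)
  have n1 : n < 1 := by
    have : (n : ℝ) < 1 := by linarith [hy.1]
    exact_mod_cast this
  have n2 : -1 < n := by
    have : (-1 : ℝ) < n := by linarith [hy.2]
    exact_mod_cast this
  obtain rfl : n = 0 := by omega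
  rw [Int.cast_zero, add_zero] at hn
  rcases le_or_gt i j.castSucc with h | h
  · linarith [hx h, hy.1]
  · linarith [hx (Fin.castSucc_lt_iff_succ_le.1 h), hy.2]

theorem turn_notMem_range_of_mem_Ioo_last {x : Fin (m + 1) → ℝ} (hx : Monotone x) {y : ℝ}
    (hy : y ∈ Set.Ioo (x (Fin.last m)) (x 0 + 1)) : turn y ∉ Set.range fun i => turn (x i) := by
  rintro ⟨i, hi⟩
  obtain ⟨n, hn⟩ := turn_eq_turn_iff.1 hi
  have a := hx (Fin.zero_le i)
  have b := hx (Fin.le_last i)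
  have n1 : n < 0 := by
    have : (n : ℝ) < 0 := by linarith [hy.1]
    exact_mod_cast this
  have n2 : -1 < n := by
    have : (-1 : ℝ) < n := by linarith [hy.2]
    exact_mod_cast this
  omega

section

variable {s : Fin (m + 1) → ℝ} {t : ℝ}

theorem gapLength_gapSet (hs : s ∈ stdSimplex ℝ (Fin (m + 1))) {j : Fin m} {y : ℝ}
    (hy : y ∈ Set.Ioo (gapPos s t j.castSucc) (gapPos s t j.succ)) :
    gapLength (gapSet s t).1 y = s j.castSucc.rev := by
  rw [gapLength_eq (S := (gapSet s t).1) (l := gapPos s t j.castSucc) (r := gapPos s t j.succ)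
    ⟨_, rfl⟩ ⟨_, rfl⟩
    (fun x hx => turn_notMem_range_of_mem_Ioo (monotone_gapPos hs.1) (gapPos_last_le hs) hx) hy,
    gapPos_succ, add_sub_cancel_left]

theorem gapLength_gapSet_last (hs : s ∈ stdSimplex ℝ (Fin (m + 1))) {y : ℝ}
    (hy : y ∈ Set.Ioo (gapPos s t (Fin.last m)) (gapPos s t 0 + 1)) :
    gapLength (gapSet s t).1 y = s 0 := by
  rw [gapLength_eq (S := (gapSet s t).1) (l := gapPos s t (Fin.last m)) (r := gapPos s t 0 + 1)
    ⟨_, rfl⟩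
    ⟨0, by simp [turn_add]⟩
    (fun x hx => turn_notMem_range_of_mem_Ioo_last (monotone_gapPos hs.1) hx) hy,
    gapPos_last, gapPos_zero, hs.2]
  ring

theorem gapLength_gapSet_first (hs : s ∈ stdSimplex ℝ (Fin (m + 1))) {y : ℝ}
    (hy : y ∈ Set.Ioo (gapPos s t (Fin.last m) - 1) (gapPos s t 0)) :
    gapLength (gapSet s t).1 y = s 0 := by
  rw [gapLength_eq (S := (gapSet s t).1) (l := gapPos s t (Fin.last m) - 1) (r := gapPos s t 0)
    ⟨Fin.last m, by simp [turn_sub]⟩ ⟨0, rfl⟩ (fun x hx h => ?_) hy,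
    gapPos_last, gapPos_zero, hs.2]
  · ring
  · refine turn_notMem_range_of_mem_Ioo_last (y := x + 1) (monotone_gapPos hs.1)
      ⟨by linarith [hx.1], by linarith [hx.2]⟩ ?_
    rw [turn_add, turn_one, mul_one]
    exact h

theorem intervalIntegral_of_eq_const_on_Ioo {f : ℝ → ℝ} {a b c : ℝ} (hab : a ≤ b)
    (h : ∀ y ∈ Set.Ioo a b, f y = c) :
    IntervalIntegrable f MeasureTheory.volume a b ∧ ∫ y in a..b, f y = (b - a) * c := by
  constructor
  · rw [intervalIntegrable_iff_integrableOn_Ioo_of_le hab]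
    exact (MeasureTheory.integrableOn_congr_fun h measurableSet_Ioo).2
      (MeasureTheory.integrableOn_const (by simp))
  · rw [intervalIntegral.integral_of_le hab, MeasureTheory.integral_Ioc_eq_integral_Ioo,
      MeasureTheory.setIntegral_congr_fun measurableSet_Ioo h]
    simp [hab]

/-- Integrating a function of the gap length counts each gap by its length. Since the integrand
depends only on the subset, such sums over gaps do not depend on the way the gaps are listed. -/
theorem integral_gapLength (hs : s ∈ stdSimplex ℝ (Fin (m + 1))) (ht : t ∈ Set.Icc (0 : ℝ) 1)
    (G : ℝ → ℝ) (j : Fin (m + 1)) :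
    IntervalIntegrable (fun y => G (gapLength (gapSet s t).1 y)) MeasureTheory.volume
      0 (gapPos s t j) ∧
    ∫ y in (0 : ℝ)..gapPos s t j, G (gapLength (gapSet s t).1 y) =
      gapPos (fun i => s i * G (s i)) t j := by
  induction j using Fin.induction with
  | zero =>
    have h := intervalIntegral_of_eq_const_on_Ioo (c := G (s 0)) (gapPos_mem_Icc hs ht 0).1
      (f := fun y => G (gapLength (gapSet s t).1 y)) (fun y hy => by
        rw [gapLength_gapSet_first hs ⟨?_, hy.2⟩]
        linarith [(gapPos_mem_Icc hs ht (Fin.last m)).2, hy.1])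
    refine ⟨h.1, h.2.trans ?_⟩
    rw [gapPos_zero, gapPos_zero]
    ring
  | succ j ih =>
    have h := intervalIntegral_of_eq_const_on_Ioo (c := G (s j.castSucc.rev))
      (monotone_gapPos (t := t) hs.1 j.castSucc_lt_succ.le)
      (f := fun y => G (gapLength (gapSet s t).1 y)) (fun y hy => by
        rw [gapLength_gapSet hs hy])
    refine ⟨ih.1.trans h.1, ?_⟩
    rw [← intervalIntegral.integral_add_adjacent_intervals ih.1 h.1, ih.2, h.2, gapPos_succ,
      gapPos_succ]
    ring

theorem integral_gapLength_one (hs : s ∈ stdSimplex ℝ (Fin (m + 1)))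
    (ht : t ∈ Set.Icc (0 : ℝ) 1) (G : ℝ → ℝ) :
    ∫ y in (0 : ℝ)..1, G (gapLength (gapSet s t).1 y) = ∑ i, s i * G (s i) := by
  have h := intervalIntegral_of_eq_const_on_Ioo (c := G (s 0))
    (gapPos_mem_Icc hs ht (Fin.last m)).2
    (f := fun y => G (gapLength (gapSet s t).1 y)) (fun y hy => by
      rw [gapLength_gapSet_last hs ⟨hy.1, ?_⟩]
      linarith [(gapPos_mem_Icc hs ht 0).1, hy.2])
  have ih := integral_gapLength hs ht G (Fin.last m)
  rw [← intervalIntegral.integral_add_adjacent_intervals ih.1 h.1, ih.2, h.2, gapPos_last,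
    gapPos_last, hs.2]
  ring

variable {s' : Fin (m + 1) → ℝ} {t' : ℝ}

theorem sum_gaps_eq (hs : s ∈ stdSimplex ℝ (Fin (m + 1))) (ht : t ∈ Set.Icc (0 : ℝ) 1)
    (hs' : s' ∈ stdSimplex ℝ (Fin (m + 1))) (ht' : t' ∈ Set.Icc (0 : ℝ) 1)
    (h : gapSet s t = gapSet s' t') (G : ℝ → ℝ) :
    ∑ i, s i * G (s i) = ∑ i, s' i * G (s' i) := by
  rw [← integral_gapLength_one hs ht, ← integral_gapLength_one hs' ht', h]

/-- The subset obtained by rescaling every gap by a factor depending on its length is the image of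
the original one under the map of the circle with derivative `G ∘ gapLength` fixing the angle
`0`. -/
theorem gapSet_rescale_val (hs : s ∈ stdSimplex ℝ (Fin (m + 1))) (ht : t ∈ Set.Icc (0 : ℝ) 1)
    {G : ℝ → ℝ} (hG : ∑ i, s i * G (s i) = 1) :
    (gapSet (fun i => s i * G (s i)) t).1 =
      (fun x : ℝ => turn (∫ y in (0 : ℝ)..x, G (gapLength (gapSet s t).1 y))) ''
        {x | x ∈ Set.Icc (0 : ℝ) 1 ∧ turn x ∈ (gapSet s t).1} := by
  rw [gapSet_val (fun i => s i * G (s i))]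
  apply Set.Subset.antisymm
  · rintro _ ⟨j, rfl⟩
    exact ⟨gapPos s t j, ⟨gapPos_mem_Icc hs ht j, j, rfl⟩,
      congrArg turn (integral_gapLength hs ht G j).2⟩
  · rintro _ ⟨x, ⟨hx, j, hj⟩, rfl⟩
    have hp := gapPos_mem_Icc hs ht j
    refine ⟨j, ?_⟩
    simp only [← (integral_gapLength hs ht G j).2]
    obtain ⟨n, hn⟩ := turn_eq_turn_iff.1 hj
    have n1 : n ≤ 1 := by
      have : (n : ℝ) ≤ 1 := by linarith [hp.2, hx.1]
      exact_mod_cast this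
    have n2 : -1 ≤ n := by
      have : (-1 : ℝ) ≤ n := by linarith [hp.1, hx.2]
      exact_mod_cast this
    have h01 : turn (∫ y in (0 : ℝ)..1, G (gapLength (gapSet s t).1 y)) =
        turn (∫ y in (0 : ℝ)..0, G (gapLength (gapSet s t).1 y)) := by
      rw [integral_gapLength_one hs ht, hG]; simp
    interval_cases n <;> push_cast at hn
    · rw [show gapPos s t j = 0 by linarith [hp.1, hx.2], show x = 1 by linarith [hp.1, hx.2],
        h01]
    · rw [show gapPos s t j = x by linarith]
    · rw [show gapPos s t j = 1 by linarith [hp.2, hx.1], show x = 0 by linarith [hp.2, hx.1],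
        h01]

theorem gapSet_rescale_eq (hs : s ∈ stdSimplex ℝ (Fin (m + 1))) (ht : t ∈ Set.Icc (0 : ℝ) 1)
    (hs' : s' ∈ stdSimplex ℝ (Fin (m + 1))) (ht' : t' ∈ Set.Icc (0 : ℝ) 1)
    (h : gapSet s t = gapSet s' t') {G : ℝ → ℝ} (hG : ∑ i, s i * G (s i) = 1) :
    gapSet (fun i => s i * G (s i)) t = gapSet (fun i => s' i * G (s' i)) t' := by
  apply Subtype.ext
  rw [gapSet_rescale_val hs ht hG,
    gapSet_rescale_val hs' ht' ((sum_gaps_eq hs ht hs' ht' h G).symm.trans hG), h]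

end

/-- Every finite subset with at most `m + 1` points is described by `m + 1` gaps. -/
theorem exists_gapSet_eq (S : FiniteSubsetSpace (m + 1) Circle) :
    ∃ s ∈ stdSimplex ℝ (Fin (m + 1)), ∃ t ∈ Set.Icc (0 : ℝ) 1, gapSet s t = S := by
  obtain ⟨f, rfl⟩ := FiniteSubsetSpace.ofTuple_surjective S
  choose y hy hyf using fun j => exists_turn_eq (f j)
  let x := y ∘ Tuple.sort y
  have hx : Monotone x := Tuple.monotone_sort y
  have hx' : ∀ j, x j ∈ Set.Ico (0 : ℝ) 1 := fun j => hy _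
  let s : Fin (m + 1) → ℝ := Fin.cases (1 - (x (Fin.last m) - x 0))
    (fun i => x i.rev.succ - x i.rev.castSucc)
  have s0 : s 0 = 1 - (x (Fin.last m) - x 0) := rfl
  have s1 : ∀ j : Fin m, s j.castSucc.rev = x j.succ - x j.castSucc := by
    intro j
    rw [Fin.rev_castSucc]
    simp [s]
  have s0pos : 0 < s 0 := by rw [s0]; linarith [(hx' 0).1, (hx' (Fin.last m)).2]
  have hpos : ∀ j, fromGaps m s j = x j - x 0 := by
    intro j
    induction j using Fin.induction with
    | zero => rw [fromGaps_zero, sub_self]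
    | succ j ih => rw [fromGaps_succ, ih, s1]; ring
  refine ⟨s, ⟨?_, ?_⟩, x 0 / s 0, ⟨?_, ?_⟩, ?_⟩
  · intro i
    induction i using Fin.cases with
    | zero => exact s0pos.le
    | succ i => exact sub_nonneg.2 (hx i.rev.castSucc_lt_succ.le)
  · have h1 := fromGaps_last s
    rw [hpos] at h1
    linarith
  · exact div_nonneg (hx' 0).1 s0pos.le
  · rw [div_le_one s0pos, s0]
    linarith [(hx' (Fin.last m)).2]
  · apply Subtype.ext
    rw [gapSet_val]
    have : (fun j => turn (gapPos s (x 0 / s 0) j)) = f ∘ Tuple.sort y := by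
      funext j
      rw [gapPos, hpos, mul_div_cancel₀ _ s0pos.ne', sub_add_cancel]
      exact hyf _
    rw [this]
    exact (Tuple.sort y).surjective.range_comp f

end Gaps

/-! ### The retraction of the space of gaps onto the star -/

section Flow

variable {m : ℕ}

theorem offDiag_univ_nonempty (hm : 1 ≤ m) :
    (Finset.univ : Finset (Fin (m + 1))).offDiag.Nonempty :=
  ⟨(0, Fin.last m), by
    simp only [Finset.mem_offDiag, Finset.mem_univ, true_and, ne_eq, Fin.ext_iff, Fin.val_zero,
      Fin.val_last]
    omega⟩

/-- The second smallest gap, counted with multiplicity. -/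
noncomputable def secondGap (hm : 1 ≤ m) (s : Fin (m + 1) → ℝ) : ℝ :=
  (Finset.univ : Finset (Fin (m + 1))).offDiag.inf' (offDiag_univ_nonempty hm)
    fun p => max (s p.1) (s p.2)

theorem continuous_secondGap (hm : 1 ≤ m) : Continuous (secondGap hm) :=
  Continuous.finset_inf'_apply _ fun p _ => by fun_prop

theorem le_secondGap_iff (hm : 1 ≤ m) {s : Fin (m + 1) → ℝ} {c : ℝ} :
    c ≤ secondGap hm s ↔ ∀ i j, i ≠ j → c ≤ s i ∨ c ≤ s j := by
  simp [secondGap, Finset.le_inf'_iff]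

theorem secondGap_pos_iff (hm : 1 ≤ m) {s : Fin (m + 1) → ℝ} :
    0 < secondGap hm s ↔ ∀ i j, i ≠ j → 0 < s i ∨ 0 < s j := by
  simp [secondGap, Finset.lt_inf'_iff]

theorem le_secondGap_iff_card (hm : 1 ≤ m) {s : Fin (m + 1) → ℝ} {c : ℝ} :
    c ≤ secondGap hm s ↔ m ≤ (Finset.univ.filter fun i => c ≤ s i).card := by
  have h := Finset.card_filter_add_card_filter_not (s := (Finset.univ : Finset (Fin (m + 1))))
    (fun i => c ≤ s i)
  rw [Finset.card_univ, Fintype.card_fin] at h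
  have h' : m ≤ (Finset.univ.filter fun i => c ≤ s i).card ↔
      (Finset.univ.filter fun i => ¬ c ≤ s i).card ≤ 1 := by omega
  rw [h', le_secondGap_iff, Finset.card_le_one]
  simp only [Finset.mem_filter, Finset.mem_univ, true_and]
  refine forall_congr' fun i => ⟨fun H hi j hj => ?_, fun H j hij => ?_⟩
  · by_contra hij
    exact (H j hij).elim hi hj
  · by_contra! hc
    exact hij (H (not_le.2 hc.1) j (not_le.2 hc.2))

variable {s s' : Fin (m + 1) → ℝ} {t t' : ℝ}

/-- The number of gaps of length at least `c > 0` is a sum over gaps, hence depends only on the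
subset; and these numbers determine the second smallest gap. -/
theorem secondGap_eq_of_gapSet_eq (hm : 1 ≤ m) (hs : s ∈ stdSimplex ℝ (Fin (m + 1)))
    (ht : t ∈ Set.Icc (0 : ℝ) 1) (hs' : s' ∈ stdSimplex ℝ (Fin (m + 1)))
    (ht' : t' ∈ Set.Icc (0 : ℝ) 1) (h : gapSet s t = gapSet s' t')
    (hp : 0 < secondGap hm s) (hp' : 0 < secondGap hm s') : secondGap hm s = secondGap hm s' := by
  have count : ∀ (s : Fin (m + 1) → ℝ) {c : ℝ}, 0 < c →
      ((Finset.univ.filter fun i => c ≤ s i).card : ℝ) =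
        ∑ i, s i * (if c ≤ s i then (s i)⁻¹ else 0) := by
    intro s c hc
    rw [Finset.card_filter]
    push_cast
    refine Finset.sum_congr rfl fun i _ => ?_
    split_ifs with hi
    · rw [mul_inv_cancel₀ (hc.trans_le hi).ne']
    · rw [mul_zero]
  have key : ∀ {c : ℝ}, 0 < c → (c ≤ secondGap hm s ↔ c ≤ secondGap hm s') := by
    intro c hc
    have e := sum_gaps_eq hs ht hs' ht' h fun x => if c ≤ x then x⁻¹ else 0
    rw [← count s hc, ← count s' hc] at e
    rw [le_secondGap_iff_card, le_secondGap_iff_card, Nat.cast_injective e]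
  exact le_antisymm ((key hp).1 le_rfl) ((key hp').2 le_rfl)

/-- The total length of the gaps after capping them at the second smallest one. -/
noncomputable def cappedSum (hm : 1 ≤ m) (s : Fin (m + 1) → ℝ) : ℝ :=
  ∑ i, min (s i) (secondGap hm s)

/-- The straight-line homotopy from `s` to the point obtained by capping all gaps at the second
smallest one and rescaling. The end point has at most one short gap and all others equal. -/
noncomputable def gapFlow (hm : 1 ≤ m) (u : ℝ) (s : Fin (m + 1) → ℝ) (i : Fin (m + 1)) : ℝ :=
  (1 - u) * s i + u * (min (s i) (secondGap hm s) / cappedSum hm s)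

theorem exists_ge_secondGap (hm : 1 ≤ m) (s : Fin (m + 1) → ℝ) :
    ∃ i, ∀ j, j ≠ i → secondGap hm s ≤ s j := by
  by_cases h : ∃ i, s i < secondGap hm s
  · obtain ⟨i, hi⟩ := h
    exact ⟨i, fun j hj => ((le_secondGap_iff hm).1 le_rfl j i hj).resolve_right (not_le.2 hi)⟩
  · push Not at h
    exact ⟨0, fun j _ => h j⟩

theorem cappedSum_eq (hm : 1 ≤ m) {s : Fin (m + 1) → ℝ} {i : Fin (m + 1)}
    (hi : ∀ j, j ≠ i → secondGap hm s ≤ s j) :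
    cappedSum hm s = min (s i) (secondGap hm s) + m * secondGap hm s := by
  rw [cappedSum, ← Finset.add_sum_erase _ _ (Finset.mem_univ i),
    Finset.sum_congr rfl fun j hj => min_eq_right (hi j (Finset.ne_of_mem_erase hj))]
  simp

theorem cappedSum_pos (hm : 1 ≤ m) (hs : ∀ i, 0 ≤ s i) (h : 0 < secondGap hm s) :
    0 < cappedSum hm s := by
  obtain ⟨i, hi⟩ := exists_ge_secondGap hm s
  rw [cappedSum_eq hm hi]
  have : 0 ≤ min (s i) (secondGap hm s) := le_min (hs i) h.le
  have hm' : (0 : ℝ) < m := by exact_mod_cast hm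
  positivity

theorem gapFlow_mem_stdSimplex (hm : 1 ≤ m) (hs : s ∈ stdSimplex ℝ (Fin (m + 1)))
    (h : 0 < secondGap hm s) {u : ℝ} (hu : u ∈ Set.Icc (0 : ℝ) 1) :
    gapFlow hm u s ∈ stdSimplex ℝ (Fin (m + 1)) := by
  have hZ := cappedSum_pos hm hs.1 h
  constructor
  · intro i
    have a := mul_nonneg (sub_nonneg.2 hu.2) (hs.1 i)
    have b := mul_nonneg hu.1 (div_nonneg (le_min (hs.1 i) h.le) hZ.le)
    exact add_nonneg a b
  · simp only [gapFlow]
    rw [Finset.sum_add_distrib, ← Finset.mul_sum, ← Finset.mul_sum, ← Finset.sum_div, hs.2,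
      ← cappedSum, div_self hZ.ne']
    ring

/-- Positive gaps stay positive along the homotopy, so it never makes a second gap vanish. -/
theorem secondGap_gapFlow_pos (hm : 1 ≤ m) (hs : s ∈ stdSimplex ℝ (Fin (m + 1)))
    (h : 0 < secondGap hm s) {u : ℝ} (hu : u ∈ Set.Icc (0 : ℝ) 1) :
    0 < secondGap hm (gapFlow hm u s) := by
  have hZ := cappedSum_pos hm hs.1 h
  have key : ∀ i, 0 < s i → 0 < gapFlow hm u s i := by
    intro i hi
    have b : 0 < min (s i) (secondGap hm s) / cappedSum hm s := div_pos (lt_min hi h) hZ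
    have a := mul_nonneg (sub_nonneg.2 hu.2) hi.le
    rcases hu.1.eq_or_lt with h0 | h0
    · rw [gapFlow, ← h0]; simpa using hi
    · exact add_pos_of_nonneg_of_pos a (mul_pos h0 b)
  rw [secondGap_pos_iff] at h ⊢
  exact fun i j hij => (h i j hij).imp (key i) (key j)

/-- The homotopy of gaps rescales every gap by a factor that depends only on its length, so it
induces a homotopy of subsets of the circle. -/
theorem gapSet_gapFlow_eq (hm : 1 ≤ m) (hs : s ∈ stdSimplex ℝ (Fin (m + 1)))
    (ht : t ∈ Set.Icc (0 : ℝ) 1) (hs' : s' ∈ stdSimplex ℝ (Fin (m + 1)))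
    (ht' : t' ∈ Set.Icc (0 : ℝ) 1) (h : gapSet s t = gapSet s' t')
    (hp : 0 < secondGap hm s) (hp' : 0 < secondGap hm s') {u : ℝ}
    (hu : u ∈ Set.Icc (0 : ℝ) 1) :
    gapSet (gapFlow hm u s) t = gapSet (gapFlow hm u s') t' := by
  have hM := secondGap_eq_of_gapSet_eq hm hs ht hs' ht' h hp hp'
  have hmin : ∀ {x : ℝ}, 0 ≤ x → x * min 1 (secondGap hm s / x) = min x (secondGap hm s) := by
    intro x hx
    rcases hx.eq_or_lt with rfl | hx
    · rw [zero_mul, min_eq_left hp.le]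
    · rw [mul_min_of_nonneg _ _ hx.le, mul_one, mul_div_cancel₀ _ hx.ne']
  have hZ : cappedSum hm s = cappedSum hm s' := by
    have := sum_gaps_eq hs ht hs' ht' h fun x => min 1 (secondGap hm s / x)
    simp only [hmin (hs.1 _), hmin (hs'.1 _)] at this
    rw [cappedSum, cappedSum, ← hM, this]
  let G : ℝ → ℝ := fun x => (1 - u) + u * (min 1 (secondGap hm s / x) / cappedSum hm s)
  have e : gapFlow hm u s = fun i => s i * G (s i) := by
    funext i
    simp only [gapFlow, G, ← hmin (hs.1 i)]
    ring
  have e' : gapFlow hm u s' = fun i => s' i * G (s' i) := by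
    funext i
    simp only [gapFlow, G, ← hM, ← hZ, ← hmin (hs'.1 i)]
    ring
  have hG : ∑ i, s i * G (s i) = 1 := by
    have := (gapFlow_mem_stdSimplex hm hs hp hu).2
    rwa [e] at this
  rw [e, e']
  exact gapSet_rescale_eq hs ht hs' ht' h hG

/-- Each vanishing gap reduces the number of points by one, so `m` points remain if and only if at
most one gap vanishes. -/
theorem gapSet_mem_codimTwoComplement_iff (hm : 1 ≤ m) (hs : s ∈ stdSimplex ℝ (Fin (m + 1)))
    (ht : t ∈ Set.Icc (0 : ℝ) 1) :
    gapSet s t ∈ codimTwoComplement (m + 1) ↔ 0 < secondGap hm s := by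
  rw [mem_codimTwoComplement_iff, gapSet_val, ← Set.image_univ]
  constructor
  · intro h
    by_contra hneg
    rw [secondGap_pos_iff] at hneg
    push Not at hneg
    obtain ⟨i, i', hne, hi, hi'⟩ := hneg
    replace hi := le_antisymm hi (hs.1 i)
    replace hi' := le_antisymm hi' (hs.1 i')
    let f := fun j => turn (gapPos s t j)
    have step : ∀ j : Fin (m + 1), s j.rev = 0 → f (j + 1) = f j := by
      intro j hj
      simp only [f]
      rw [turn_gapPos_add_one hs.2, hj, turn_zero, mul_one]
    obtain ⟨j, rfl⟩ := Fin.rev_surjective i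
    obtain ⟨j', rfl⟩ := Fin.rev_surjective i'
    have hjj : j ≠ j' := fun e => hne (by rw [e])
    have m2 : 2 ≤ m := by
      by_contra hlt
      obtain rfl : m = 1 := by omega
      have := hs.2
      rw [Fin.sum_univ_two] at this
      have h01 : s 0 = 0 ∧ s 1 = 0 := by
        clear_value f
        fin_cases j <;> fin_cases j' <;> simp_all [Fin.rev]
      rw [h01.1, h01.2] at this
      norm_num at this
    have one_ne : (1 : Fin (m + 1)) ≠ 0 := by
      rw [Ne, Fin.ext_iff, Fin.val_one', Fin.val_zero, Nat.mod_eq_of_lt (by omega)]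
      omega
    have two_ne : (1 + 1 : Fin (m + 1)) ≠ 0 := by
      rw [Ne, Fin.ext_iff, Fin.val_add, Fin.val_one', Fin.val_zero, Nat.mod_eq_of_lt (a := 1)
        (by omega), Nat.mod_eq_of_lt (by omega)]
      omega
    -- The next point after `a` outside `{a, b}` coincides with the point `a`.
    have aux : ∀ a b : Fin (m + 1), a ≠ b → f (a + 1) = f a → f (b + 1) = f b →
        ∃ c, c ≠ a ∧ c ≠ b ∧ f c = f a := by
      intro a b hab ha hb
      by_cases h1 : a + 1 = b
      · refine ⟨b + 1, ?_, ?_, ?_⟩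
        · rw [← h1, add_assoc]
          simpa using two_ne
        · simpa using one_ne
        · rw [hb, ← h1, ha]
      · exact ⟨a + 1, by simpa using one_ne, h1, ha⟩
    have hsub : f '' Set.univ ⊆
        f '' (((Finset.univ.erase j).erase j' : Finset (Fin (m + 1))) : Set (Fin (m + 1))) := by
      rintro _ ⟨a, -, rfl⟩
      by_cases ha : a = j
      · obtain ⟨c, c1, c2, hc⟩ := aux j j' hjj (step j hi) (step j' hi')
        exact ⟨c, by simp [c1, c2], by rw [hc, ha]⟩
      by_cases ha' : a = j'
      · obtain ⟨c, c1, c2, hc⟩ := aux j' j hjj.symm (step j' hi') (step j hi)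
        exact ⟨c, by simp [c1, c2], by rw [hc, ha']⟩
      exact ⟨a, by simp [ha, ha'], rfl⟩
    have h1 := Set.ncard_le_ncard hsub ((Finset.finite_toSet _).image f)
    have h2 := Set.ncard_image_le (f := f)
      (Finset.finite_toSet ((Finset.univ.erase j).erase j' : Finset (Fin (m + 1))))
    rw [Set.ncard_coe_finset, Finset.card_erase_of_mem (by simp [hjj.symm]),
      Finset.card_erase_of_mem (Finset.mem_univ _), Finset.card_univ, Fintype.card_fin] at h2
    have h3 : m + 1 - 2 < (f '' Set.univ).ncard := h
    omega
  · intro h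
    rw [secondGap_pos_iff] at h
    -- All points are distinct after omitting the start of the zero gap, if there is one.
    obtain ⟨j₀, hj₀⟩ : ∃ j₀ : Fin (m + 1), ∀ j, j ≠ j₀ → 0 < s j.rev := by
      by_cases hz : ∃ j : Fin (m + 1), s j.rev = 0
      · obtain ⟨j₀, hj₀⟩ := hz
        exact ⟨j₀, fun j hj => (h j.rev j₀.rev (Fin.rev_injective.ne hj)).resolve_right
          (by simp [hj₀])⟩
      · push Not at hz
        exact ⟨0, fun j _ => (hs.1 _).lt_of_ne' (hz j)⟩
    have hmono := monotone_gapPos (t := t) hs.1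
    have main : ∀ i j : Fin (m + 1), i ≠ j₀ → j ≠ j₀ → i < j →
        turn (gapPos s t i) ≠ turn (gapPos s t j) := by
      intro i j hi hj hij e
      obtain ⟨n, hn⟩ := turn_eq_turn_iff.1 e
      have a := gapPos_mem_Icc hs ht i
      have b := gapPos_mem_Icc hs ht j
      have hne : i ≠ Fin.last m := (hij.trans_le (Fin.le_last j)).ne
      obtain ⟨i, rfl⟩ := Fin.exists_castSucc_eq.2 hne
      have c := hmono (Fin.castSucc_lt_iff_succ_le.1 hij)
      rw [gapPos_succ] at c
      have d := hj₀ _ hi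
      have n1 : n < 0 := by
        have : (n : ℝ) < 0 := by linarith
        exact_mod_cast this
      have n2 : -1 ≤ n := by
        have : (-1 : ℝ) ≤ n := by linarith [a.1, b.2]
        exact_mod_cast this
      obtain rfl : n = -1 := by omega
      push_cast at hn
      have e1 : gapPos s t j = 1 := by linarith [a.1, b.2]
      have e0 : gapPos s t i.castSucc = 0 := by linarith [a.1, b.2]
      have f0 := hmono (Fin.zero_le i.castSucc)
      have f1 := hmono (Fin.le_last j)
      have s0 : s 0 ≤ 0 := by
        rw [gapPos_zero, e0] at f0
        rw [gapPos_last, hs.2, e1] at f1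
        linarith
      have hlast : Fin.last m = j₀ := by
        by_contra hl
        have := hj₀ _ hl
        rw [Fin.rev_last] at this
        linarith
      obtain ⟨j, rfl⟩ := Fin.exists_castSucc_eq.2 (fun hjl => hj (hjl.trans hlast))
      have g := (gapPos_mem_Icc hs ht j.succ).2
      rw [gapPos_succ] at g
      linarith [hj₀ _ hj]
    have hinj : Set.InjOn (fun j => turn (gapPos s t j))
        ((Finset.univ.erase j₀ : Finset (Fin (m + 1))) : Set (Fin (m + 1))) := by
      intro i hi j hj e
      simp only [Finset.coe_erase, Finset.coe_univ, Set.mem_sdiff, Set.mem_univ, true_and,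
        Set.mem_singleton_iff] at hi hj
      rcases lt_trichotomy i j with hlt | heq | hgt
      · exact absurd e (main i j hi hj hlt)
      · exact heq
      · exact absurd e.symm (main j i hj hi hgt)
    have h1 := Set.ncard_le_ncard (Set.image_mono (f := fun j => turn (gapPos s t j))
      (Set.subset_univ ((Finset.univ.erase j₀ : Finset (Fin (m + 1))) : Set (Fin (m + 1)))))
      (Set.finite_univ.image _)
    rw [hinj.ncard_image, Set.ncard_coe_finset,
      Finset.card_erase_of_mem (Finset.mem_univ _), Finset.card_univ, Fintype.card_fin] at h1
    omega

end Flow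

/-! ### Subsets with at most one short gap -/

section Star

variable {m : ℕ}

/-- Gaps in the ratio `ρ : 1 : ⋯ : 1`, the `i`-th one being the short one. -/
noncomputable def starGap (m : ℕ) (ρ : ℝ) (i j : Fin (m + 1)) : ℝ :=
  if j = i then ρ / (m + ρ) else 1 / (m + ρ)

theorem starGap_mem_stdSimplex (hm : 1 ≤ m) {ρ : ℝ} (hρ : ρ ∈ Set.Icc (0 : ℝ) 1)
    (i : Fin (m + 1)) : starGap m ρ i ∈ stdSimplex ℝ (Fin (m + 1)) := by
  have hm' : (1 : ℝ) ≤ m := by exact_mod_cast hm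
  have h : 0 < (m : ℝ) + ρ := by linarith [hρ.1]
  have h0 := hρ.1
  constructor
  · intro j
    simp only [starGap]
    split_ifs <;> positivity
  · have hj : ∀ j ∈ Finset.univ.erase i, starGap m ρ i j = 1 / (m + ρ) :=
      fun j hj => if_neg (Finset.ne_of_mem_erase hj)
    rw [← Finset.add_sum_erase _ _ (Finset.mem_univ i), Finset.sum_congr rfl hj, starGap,
      if_pos rfl]
    simp
    field_simp
    ring

theorem secondGap_starGap (hm : 1 ≤ m) {ρ : ℝ} (hρ : ρ ∈ Set.Icc (0 : ℝ) 1) (i : Fin (m + 1)) :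
    secondGap hm (starGap m ρ i) = 1 / (m + ρ) := by
  have hm' : (1 : ℝ) ≤ m := by exact_mod_cast hm
  have h : 0 < (m : ℝ) + ρ := by linarith [hρ.1]
  have hle : ρ / (m + ρ) ≤ 1 / (m + ρ) := by
    have := hρ.2
    gcongr
  apply le_antisymm
  · have : ∃ j : Fin (m + 1), j ≠ i := by
      by_contra! hj
      have a := (hj 0).trans (hj (Fin.last m)).symm
      rw [Fin.ext_iff] at a
      simp only [Fin.val_zero, Fin.val_last] at a
      omega
    obtain ⟨j, hj⟩ := this
    rcases (le_secondGap_iff hm).1 (le_refl (secondGap hm (starGap m ρ i))) i j hj.symm with a | a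
    · rw [starGap, if_pos rfl] at a
      exact a.trans hle
    · rwa [starGap, if_neg hj] at a
  · rw [le_secondGap_iff]
    intro a b hab
    by_cases ha : a = i
    · right
      rw [starGap, if_neg fun hb => hab (ha.trans hb.symm)]
    · left
      rw [starGap, if_neg ha]

theorem gapFlow_starGap (hm : 1 ≤ m) {ρ : ℝ} (hρ : ρ ∈ Set.Icc (0 : ℝ) 1) (i : Fin (m + 1))
    (u : ℝ) : gapFlow hm u (starGap m ρ i) = starGap m ρ i := by
  have hm' : (1 : ℝ) ≤ m := by exact_mod_cast hm
  have h : 0 < (m : ℝ) + ρ := by linarith [hρ.1]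
  have hmin : ∀ j, min (starGap m ρ i j) (secondGap hm (starGap m ρ i)) = starGap m ρ i j := by
    intro j
    rw [secondGap_starGap hm hρ]
    apply min_eq_left
    have := hρ.2
    simp only [starGap]
    split_ifs
    · gcongr
    · exact le_rfl
  funext j
  rw [gapFlow, cappedSum]
  simp only [hmin]
  rw [(starGap_mem_stdSimplex hm hρ i).2]
  ring

theorem gapFlow_one (hm : 1 ≤ m) {s : Fin (m + 1) → ℝ} (hs : ∀ i, 0 ≤ s i)
    (h : 0 < secondGap hm s) :
    ∃ ρ ∈ Set.Icc (0 : ℝ) 1, ∃ i, gapFlow hm 1 s = starGap m ρ i := by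
  have hm' : (1 : ℝ) ≤ m := by exact_mod_cast hm
  obtain ⟨i, hi⟩ := exists_ge_secondGap hm s
  have h0 : 0 ≤ min (s i) (secondGap hm s) := le_min (hs i) h.le
  refine ⟨min (s i) (secondGap hm s) / secondGap hm s, ⟨by positivity,
    (div_le_one h).2 (min_le_right _ _)⟩, i, ?_⟩
  funext j
  rw [gapFlow, cappedSum_eq hm hi, starGap]
  split_ifs with hj
  · subst hj
    field_simp
    ring
  · rw [min_eq_right (hi j hj)]
    field_simp
    ring

theorem simplexBarycentre_eq (m : ℕ) :
    simplexBarycentre (m + 1) = fromGaps m fun _ => 1 / ((m : ℝ) + 1) := by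
  rw [simplexBarycentre, fromGaps, Fintype.linearCombination_apply, Finset.smul_sum]
  simp

theorem faceBarycentre_eq (i : Fin (m + 1)) :
    faceBarycentre (m + 1) i = fromGaps m fun j => if j = i then 0 else 1 / (m : ℝ) := by
  rw [faceBarycentre, fromGaps, Fintype.linearCombination_apply, Finset.smul_sum,
    ← Finset.add_sum_erase _ _ (Finset.mem_univ i), if_pos rfl, zero_smul, zero_add]
  refine Finset.sum_congr rfl fun j hj => ?_
  rw [if_neg (Finset.ne_of_mem_erase hj)]
  simp

theorem starGraph_eq (hm : 1 ≤ m) : starGraph (m + 1) =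
    {a | ∃ ρ ∈ Set.Icc (0 : ℝ) 1, ∃ i, fromGaps m (starGap m ρ i) = a} := by
  have hm' : (1 : ℝ) ≤ m := by exact_mod_cast hm
  ext a
  simp only [starGraph, Set.mem_iUnion, Set.mem_ofPred_eq, simplexBarycentre_eq, faceBarycentre_eq,
    segment_eq_image]
  constructor
  · rintro ⟨i, l, hl, rfl⟩
    -- The ratio of the short gap to the others at the parameter `l` of the segment.
    have hd : 0 < m + l := by linarith [hl.1]
    have h1l : 0 ≤ 1 - l := by linarith [hl.2]
    refine ⟨(1 - l) * m / (m + l), ⟨by positivity, (div_le_one hd).2 (by nlinarith [hl.1])⟩, i, ?_⟩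
    have hW : (m : ℝ) + (1 - l) * m / (m + l) = m * (m + 1) / (m + l) := by
      field_simp
      ring
    simp only [← map_smul, ← map_add]
    congr 1
    funext j
    simp only [starGap, Pi.add_apply, Pi.smul_apply, smul_eq_mul, hW]
    split_ifs
    · field_simp
      ring
    · field_simp
      ring
  · rintro ⟨ρ, hρ, i, rfl⟩
    have h : 0 < (m : ℝ) + ρ := by linarith [hρ.1]
    refine ⟨i, 1 - (m + 1) * (ρ / (m + ρ)), ⟨?_, ?_⟩, ?_⟩
    · rw [sub_nonneg, ← mul_div_assoc, div_le_one h]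
      nlinarith [hρ.2]
    · have := hρ.1
      have : 0 ≤ ((m : ℝ) + 1) * (ρ / (m + ρ)) := by positivity
      linarith
    · simp only [← map_smul, ← map_add]
      congr 1
      funext j
      simp only [starGap, Pi.add_apply, Pi.smul_apply, smul_eq_mul]
      split_ifs
      · field_simp
        ring
      · field_simp
        ring

theorem mem_starImage_iff (hm : 1 ≤ m) [NeZero (m + 1)] {S : FiniteSubsetSpace (m + 1) Circle} :
    S ∈ starImage (m + 1) ↔ ∃ ρ ∈ Set.Icc (0 : ℝ) 1, ∃ i, ∃ t ∈ Set.Icc (0 : ℝ) 1,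
      gapSet (starGap m ρ i) t = S := by
  rw [starImage, starGraph_eq hm]
  constructor
  · rintro ⟨⟨a, t⟩, ⟨⟨ρ, hρ, i, h⟩, ht⟩, rfl⟩
    refine ⟨ρ, hρ, i, t, ht, ?_⟩
    rw [← simplexMap_fromGaps (starGap_mem_stdSimplex hm hρ i).2]
    simp only at h
    rw [h]
  · rintro ⟨ρ, hρ, i, t, ht, rfl⟩
    exact ⟨(fromGaps m (starGap m ρ i), t), ⟨⟨ρ, hρ, i, rfl⟩, ht⟩,
      simplexMap_fromGaps (starGap_mem_stdSimplex hm hρ i).2 t⟩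

theorem starImage_subset (hm : 1 ≤ m) [NeZero (m + 1)] :
    starImage (m + 1) ⊆ codimTwoComplement (m + 1) := by
  intro S hS
  obtain ⟨ρ, hρ, i, t, ht, rfl⟩ := (mem_starImage_iff hm).1 hS
  rw [gapSet_mem_codimTwoComplement_iff hm (starGap_mem_stdSimplex hm hρ i) ht,
    secondGap_starGap hm hρ]
  have hm' : (1 : ℝ) ≤ m := by exact_mod_cast hm
  have := hρ.1
  positivity

theorem continuous_gapFlow (hm : 1 ≤ m) {X : Type*} [TopologicalSpace X] {u : X → ℝ}
    {s : X → Fin (m + 1) → ℝ} (hu : Continuous u) (hs : Continuous s) (h0 : ∀ x i, 0 ≤ s x i)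
    (hp : ∀ x, 0 < secondGap hm (s x)) : Continuous fun x => gapFlow hm (u x) (s x) := by
  have hmin : ∀ i, Continuous fun x => min (s x i) (secondGap hm (s x)) := fun i =>
    ((continuous_apply i).comp hs).min ((continuous_secondGap hm).comp hs)
  have hZ : Continuous fun x => cappedSum hm (s x) := continuous_finsetSum _ fun i _ => hmin i
  refine continuous_pi fun i => ?_
  have h1 : Continuous fun x => s x i := (continuous_apply i).comp hs
  have h2 := (hmin i).div hZ fun x => (cappedSum_pos hm (h0 x) (hp x)).ne'
  exact ((continuous_const.sub hu).mul h1).add (hu.mul h2)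

/-- The homotopy of gaps deforms the complement onto the subsets with at most one short gap. -/
theorem isDeformationRetract_starImage (hm : 1 ≤ m) :
    IsDeformationRetract ((↑) ⁻¹' starImage (m + 1) : Set (codimTwoComplement (m + 1))) := by
  let q : stdSimplex ℝ (Fin (m + 1)) × I → FiniteSubsetSpace (m + 1) Circle :=
    fun p => gapSet p.1.1 p.2
  have qcont : Continuous q := Continuous.gapSet
    (continuous_subtype_val.comp continuous_fst) (continuous_subtype_val.comp continuous_snd)
  have qsurj : Function.Surjective q := by
    intro S
    obtain ⟨s, hs, t, ht, h⟩ := exists_gapSet_eq S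
    exact ⟨(⟨s, hs⟩, ⟨t, ht⟩), h⟩
  let C := codimTwoComplement (m + 1)
  let X := q ⁻¹' C
  have hX : ∀ p : X, 0 < secondGap hm p.1.1.1 := fun p =>
    (gapSet_mem_codimTwoComplement_iff hm p.1.1.2 p.1.2.2).1 p.2
  let g : I × X → FiniteSubsetSpace (m + 1) Circle := fun r =>
    gapSet (gapFlow hm r.1 r.2.1.1.1) r.2.1.2
  have gcont : Continuous g := by
    have hflow : Continuous fun r : I × X => gapFlow hm r.1 (r.2.1.1.1 : Fin (m + 1) → ℝ) :=
      continuous_gapFlow hm (by fun_prop) (by fun_prop) (fun r => r.2.1.1.2.1) fun r => hX r.2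
    have ht : Continuous fun r : I × X => (r.2.1.2 : ℝ) := by fun_prop
    exact hflow.gapSet ht
  have hgC : ∀ r, g r ∈ C := fun r =>
    (gapSet_mem_codimTwoComplement_iff hm
      (gapFlow_mem_stdSimplex hm r.2.1.1.2 (hX r.2) r.1.2) r.2.1.2.2).2
      (secondGap_gapFlow_pos hm r.2.1.1.2 (hX r.2) r.1.2)
  have hfib : ∀ u (p p' : X), q p = q p' → g (u, p) = g (u, p') := fun u p p' h =>
    gapSet_gapFlow_eq hm p.1.1.2 p.1.2.2 p'.1.1.2 p'.1.2.2 h (hX p) (hX p') u.2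
  refine IsDeformationRetract.of_isProperMap (qcont.isProperMap.restrictPreimage C)
    (Set.restrictPreimage_surjective _ qsurj) _ (h := fun r => ⟨g r, hgC r⟩)
    (gcont.subtype_mk _) ?_ ?_ ?_ ?_
  · intro p
    apply Subtype.ext
    change gapSet (gapFlow hm 0 p.1.1.1) p.1.2 = gapSet p.1.1.1 p.1.2
    congr 1
    funext i
    simp [gapFlow]
  · intro p
    obtain ⟨ρ, hρ, i, h⟩ := gapFlow_one hm p.1.1.2.1 (hX p)
    rw [Set.mem_preimage, mem_starImage_iff hm]
    exact ⟨ρ, hρ, i, p.1.2, p.1.2.2, by rw [← h]; rfl⟩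
  · intro u p hp
    rw [Set.mem_preimage, mem_starImage_iff hm] at hp
    obtain ⟨ρ, hρ, i, t, ht, e⟩ := hp
    have e : gapSet (starGap m ρ i) t = q p := e
    let p' : X := ⟨(⟨starGap m ρ i, starGap_mem_stdSimplex hm hρ i⟩, ⟨t, ht⟩), by
      change gapSet (starGap m ρ i) t ∈ C
      rw [e]
      exact p.2⟩
    apply Subtype.ext
    change g (u, p) = q p
    rw [hfib u p p' e.symm]
    change gapSet (gapFlow hm u (starGap m ρ i)) t = q p
    rw [gapFlow_starGap hm hρ, e]
  · intro u p p' h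
    exact Subtype.ext (hfib u p p' (congrArg Subtype.val h))

/-! ### The cylinder of subsets with one short gap -/

/-- The subset of the circle whose gaps are in the ratio `ρ : 1 : ⋯ : 1`, the short one being
centred at `z`. -/
noncomputable def ringSet (m : ℕ) (p : I × Circle) : FiniteSubsetSpace (m + 1) Circle :=
  FiniteSubsetSpace.ofTuple fun j => p.2 * turn ((p.1 / 2 + (j : ℕ)) / (m + p.1))

theorem continuous_ringSet (hm : 1 ≤ m) : Continuous (ringSet m) := by
  refine FiniteSubsetSpace.continuous_ofTuple.comp (continuous_pi fun j => ?_)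
  have hm' : (1 : ℝ) ≤ m := by exact_mod_cast hm
  have : Continuous fun p : I × Circle => ((p.1 : ℝ) / 2 + (j : ℕ)) / (m + p.1) :=
    Continuous.div (by fun_prop) (by fun_prop) fun p => by
      have := p.1.2.1
      positivity
  fun_prop

/-- Starting behind the short gap, one meets the points of a star subset at equal distances. -/
theorem turn_gapPos_starGap (hm : 1 ≤ m) (ρ : I) (t : ℝ) (j₀ : Fin (m + 1)) {z : Circle}
    (hz : turn (gapPos (starGap m ρ j₀.rev) t (j₀ + 1)) = z * turn (ρ / 2 / (m + ρ)))
    (n : Fin (m + 1)) :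
    turn (gapPos (starGap m ρ j₀.rev) t (j₀ + 1 + n)) =
      z * turn ((ρ / 2 + (n : ℕ)) / (m + ρ)) := by
  induction n using Fin.induction with
  | zero => simpa using hz
  | succ n ih =>
    have e : j₀ + 1 + n.succ = j₀ + 1 + n.castSucc + 1 := by
      rw [← Fin.coeSucc_eq_succ, add_assoc (j₀ + 1)]
    have hne : (j₀ + 1 + n.castSucc).rev ≠ j₀.rev := by
      refine Fin.rev_injective.ne fun h => Fin.succ_ne_zero n ?_
      rw [add_assoc] at h
      have h0 : 1 + n.castSucc = 0 := add_eq_left.1 h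
      rw [← Fin.coeSucc_eq_succ]
      exact (add_comm _ _).trans h0
    rw [e, turn_gapPos_add_one (starGap_mem_stdSimplex hm ρ.2 _).2, ih, mul_assoc,
      ← turn_add, starGap, if_neg hne, ← add_div, Fin.val_castSucc, Fin.val_succ]
    push_cast
    ring_nf

theorem gapSet_starGap (hm : 1 ≤ m) (ρ : I) (t : ℝ) (j₀ : Fin (m + 1)) {z : Circle}
    (hz : turn (gapPos (starGap m ρ j₀.rev) t (j₀ + 1)) = z * turn (ρ / 2 / (m + ρ))) :
    gapSet (starGap m ρ j₀.rev) t = ringSet m (ρ, z) := by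
  apply Subtype.ext
  rw [gapSet_val, ← (Equiv.addLeft (j₀ + 1)).surjective.range_comp]
  change _ = Set.range _
  congr 1
  funext j
  exact turn_gapPos_starGap hm ρ t j₀ hz j

theorem gapPos_starGap_last (ρ t : ℝ) :
    gapPos (starGap m ρ (Fin.last m).rev) t (Fin.last m + 1) = t * (ρ / (m + ρ)) := by
  rw [Fin.last_add_one, gapPos_zero, Fin.rev_last, starGap, if_pos rfl, mul_comm]

theorem gapPos_starGap_castSucc (ρ t : ℝ) (j₀ : Fin m) :
    gapPos (starGap m ρ j₀.castSucc.rev) t (j₀.castSucc + 1) = (t + (j₀ : ℕ) + ρ) / (m + ρ) := by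
  have key : ∀ j : Fin (m + 1), j ≤ j₀.castSucc →
      gapPos (starGap m ρ j₀.castSucc.rev) t j = (t + (j : ℕ)) / (m + ρ) := by
    intro j
    induction j using Fin.induction with
    | zero =>
      intro _
      have : (0 : Fin (m + 1)) ≠ j₀.castSucc.rev := by
        rw [Fin.rev_castSucc]; exact (Fin.succ_ne_zero _).symm
      rw [gapPos_zero, starGap, if_neg this]
      simp
      ring
    | succ j ih =>
      intro hj
      have hlt : j.castSucc < j₀.castSucc := Fin.castSucc_lt_iff_succ_le.2 hj
      rw [gapPos_succ, ih hlt.le, starGap, if_neg (Fin.rev_injective.ne hlt.ne), ← add_div]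
      simp
      ring
  rw [Fin.coeSucc_eq_succ, gapPos_succ, key _ le_rfl, starGap, if_pos rfl, ← add_div]
  simp

theorem exists_gapSet_starGap_eq_ringSet (hm : 1 ≤ m) (ρ : I) (z : Circle) :
    ∃ i, ∃ t ∈ Set.Icc (0 : ℝ) 1, gapSet (starGap m ρ i) t = ringSet m (ρ, z) := by
  have hm' : (1 : ℝ) ≤ m := by exact_mod_cast hm
  have h : 0 < (m : ℝ) + ρ := by linarith [ρ.2.1]
  -- The angle, in units of the long gaps, of the first point after the short gap.
  obtain ⟨y, hy, hyz⟩ := exists_turn_eq (z * turn (ρ / 2 / (m + ρ)))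
  obtain ⟨x, rfl⟩ : ∃ x, y = x / (m + ρ) :=
    ⟨y * (m + ρ), (mul_div_cancel_right₀ _ h.ne').symm⟩
  have x0 : 0 ≤ x := by
    have := mul_nonneg hy.1 h.le
    rwa [div_mul_cancel₀ _ h.ne'] at this
  have x1 : x < m + ρ := (div_lt_one h).1 hy.2
  by_cases hx : x ≤ ρ
  · refine ⟨(Fin.last m).rev, x / ρ,
      ⟨div_nonneg x0 ρ.2.1, div_le_one_of_le₀ hx ρ.2.1⟩, gapSet_starGap hm ρ _ _ ?_⟩
    rw [gapPos_starGap_last, ← hyz]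
    congr 1
    rcases eq_or_ne (ρ : ℝ) 0 with h0 | h0
    · have : x = 0 := le_antisymm (by linarith) x0
      simp [h0, this]
    · field_simp
  · push Not at hx
    have f0 := Nat.floor_le (sub_nonneg.2 hx.le)
    have f1 := Nat.lt_floor_add_one (x - ρ)
    have hj : ⌊x - ρ⌋₊ < m := (Nat.floor_lt (sub_nonneg.2 hx.le)).2 (by linarith)
    refine ⟨(Fin.castSucc ⟨_, hj⟩).rev, x - ρ - ⌊x - ρ⌋₊,
      ⟨by linarith, by linarith⟩, gapSet_starGap hm ρ _ _ ?_⟩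
    rw [gapPos_starGap_castSucc, ← hyz]
    congr 2
    simp

theorem range_ringSet (hm : 1 ≤ m) [NeZero (m + 1)] :
    Set.range (ringSet m) = starImage (m + 1) := by
  ext S
  rw [mem_starImage_iff hm]
  constructor
  · rintro ⟨⟨ρ, z⟩, rfl⟩
    exact ⟨ρ, ρ.2, exists_gapSet_starGap_eq_ringSet hm ρ z⟩
  · rintro ⟨ρ, hρ, i, t, ht, rfl⟩
    obtain ⟨j₀, rfl⟩ := Fin.rev_surjective i
    refine ⟨(⟨ρ, hρ⟩, turn (gapPos (starGap m ρ j₀.rev) t (j₀ + 1)) / turn (ρ / 2 / (m + ρ))), ?_⟩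
    exact (gapSet_starGap hm ⟨ρ, hρ⟩ t j₀ (by simp)).symm

/-- At the end `ρ = 0` the subsets are the regular `m`-gons. -/
theorem ringSet_zero_val (hm : 1 ≤ m) (z : Circle) :
    (ringSet m (0, z)).1 = {w | w ^ m = z ^ m} := by
  rw [← range_mul_turn_div (k := m + 1) hm (Nat.le_succ m)]
  change Set.range _ = _
  simp

/-- At the end `ρ = 1` the subsets are the regular `(m + 1)`-gons. -/
theorem ringSet_one_val (z : Circle) :
    (ringSet m (1, z)).1 =
      {w | w ^ (m + 1) = (z * turn (1 / 2 / ((m + 1 : ℕ) : ℝ))) ^ (m + 1)} := by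
  rw [← range_mul_turn_div (k := m + 1) m.succ_pos le_rfl]
  change Set.range _ = _
  congr 1
  funext j
  rw [mul_assoc, ← turn_add, ← add_div]
  simp

/-- In between, the centre of the short gap can be recovered from the sum of the elements. -/
theorem ringSet_injective_of_mem_Ioo (hm : 1 ≤ m) {ρ : I} (h₀ : 0 < (ρ : ℝ)) (h₁ : (ρ : ℝ) < 1)
    {z z' : Circle} (h : ringSet m (ρ, z) = ringSet m (ρ, z')) : z = z' := by
  have hm' : (1 : ℝ) ≤ m := by exact_mod_cast hm
  have hd : 0 < (m : ℝ) + ρ := by linarith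
  let C : ℂ := ∑ j : Fin (m + 1), (turn ((ρ / 2 + (j : ℕ)) / (m + ρ)) : ℂ)
  have hsum : ∀ z : Circle, ∑ᶠ w ∈ (ringSet m (ρ, z)).1, (w : ℂ) = z * C := by
    intro z
    have hinj : Function.Injective fun j : Fin (m + 1) =>
        z * turn ((ρ / 2 + (j : ℕ)) / (m + ρ)) := by
      intro i j hij
      obtain ⟨n, hn⟩ := turn_eq_turn_iff.1 (mul_left_cancel hij)
      have e : ((i : ℕ) : ℝ) - (j : ℕ) = n * (m + ρ) := by
        field_simp at hn
        linarith
      have hi : ((i : ℕ) : ℝ) ≤ m := by exact_mod_cast i.is_le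
      have hj : ((j : ℕ) : ℝ) ≤ m := by exact_mod_cast j.is_le
      have hi0 : (0 : ℝ) ≤ (i : ℕ) := Nat.cast_nonneg _
      have hj0 : (0 : ℝ) ≤ (j : ℕ) := Nat.cast_nonneg _
      have n1 : n < 1 := by
        by_contra hc
        have : (1 : ℝ) ≤ n := by exact_mod_cast not_lt.1 hc
        nlinarith
      have n2 : -1 < n := by
        by_contra hc
        have : (n : ℝ) ≤ -1 := by exact_mod_cast not_lt.1 hc
        nlinarith
      obtain rfl : n = 0 := by omega
      rw [Int.cast_zero, zero_mul, sub_eq_zero] at e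
      exact Fin.ext (by exact_mod_cast e)
    change ∑ᶠ w ∈ Set.range (fun j : Fin (m + 1) => z * turn ((ρ / 2 + (j : ℕ)) / (m + ρ))),
      (w : ℂ) = _
    rw [finsum_mem_range hinj, finsum_eq_sum_of_fintype, Finset.mul_sum]
    rfl
  have hC : C ≠ 0 := by
    have e : C = turn (ρ / 2 / (m + ρ)) *
        ∑ j ∈ Finset.range (m + 1), (turn (1 / (m + ρ)) : ℂ) ^ j := by
      rw [Finset.mul_sum, ← Fin.sum_univ_eq_sum_range
        (fun j => (turn (ρ / 2 / (m + ρ)) : ℂ) * (turn (1 / (m + ρ)) : ℂ) ^ j)]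
      refine Finset.sum_congr rfl fun j _ => ?_
      rw [← Circle.coe_pow, ← Circle.coe_mul, turn_pow, ← turn_add]
      congr 2
      ring
    rw [e]
    refine mul_ne_zero (Circle.coe_ne_zero _) fun h0 => ?_
    have h2 := geom_sum_mul (turn (1 / (m + ρ)) : ℂ) (m + 1)
    rw [h0, zero_mul, eq_comm, sub_eq_zero, ← Circle.coe_pow, Circle.coe_eq_one, turn_pow,
      ← turn_zero, turn_eq_turn_iff] at h2
    obtain ⟨n, hn⟩ := h2
    -- The `m + 1` long gaps would add up to more than one and less than two full turns.
    have e2 : (m : ℝ) + 1 = n * (m + ρ) := by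
      push_cast at hn
      field_simp at hn
      linarith
    have n1 : 1 < n := by
      by_contra hc
      have : (n : ℝ) ≤ 1 := by exact_mod_cast not_lt.1 hc
      nlinarith
    have : (2 : ℝ) ≤ n := by exact_mod_cast n1
    nlinarith
  have := hsum z'
  rw [← h, hsum z] at this
  exact Circle.ext (mul_right_cancel₀ hC this)

theorem isTorusCylinder_ringSet (hm : 1 ≤ m) : IsTorusCylinder m (ringSet m) := by
  have hm' : (1 : ℝ) ≤ m := by exact_mod_cast hm
  have root : ∀ {z z' : Circle}, ringSet m (1, z) = ringSet m (1, z') ↔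
      z ^ (m + 1) = z' ^ (m + 1) := by
    intro z z'
    constructor
    · intro h
      have h1 : z * turn (1 / 2 / ((m + 1 : ℕ) : ℝ)) ∈ (ringSet m (1, z')).1 := by
        rw [← h, ringSet_one_val]
        rfl
      rw [ringSet_one_val, Set.mem_ofPred_eq, mul_pow, mul_pow] at h1
      exact mul_right_cancel h1
    · intro h
      apply Subtype.ext
      rw [ringSet_one_val, ringSet_one_val, mul_pow, mul_pow, h]
  have root' : ∀ {z z' : Circle}, ringSet m (0, z) = ringSet m (0, z') ↔ z ^ m = z' ^ m := by
    intro z z'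
    constructor
    · intro h
      have h1 : z ∈ (ringSet m (0, z')).1 := by
        rw [← h, ringSet_zero_val hm]
        rfl
      rwa [ringSet_zero_val hm] at h1
    · intro h
      apply Subtype.ext
      rw [ringSet_zero_val hm, ringSet_zero_val hm, h]
  have ratio : ∀ {ρ ρ' : I} {z z' : Circle}, ringSet m (ρ, z) = ringSet m (ρ', z') → ρ = ρ' := by
    intro ρ ρ' z z' h
    have pos : ∀ ρ : I, 0 < (m : ℝ) + ρ := fun ρ => by linarith [ρ.2.1]
    obtain ⟨i, t, ht, e⟩ := exists_gapSet_starGap_eq_ringSet hm ρ z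
    obtain ⟨i', t', ht', e'⟩ := exists_gapSet_starGap_eq_ringSet hm ρ' z'
    have := secondGap_eq_of_gapSet_eq hm (starGap_mem_stdSimplex hm ρ.2 i) ht
      (starGap_mem_stdSimplex hm ρ'.2 i') ht' (e.trans (h.trans e'.symm))
      (by rw [secondGap_starGap hm ρ.2]; exact one_div_pos.2 (pos ρ))
      (by rw [secondGap_starGap hm ρ'.2]; exact one_div_pos.2 (pos ρ'))
    rw [secondGap_starGap hm ρ.2, secondGap_starGap hm ρ'.2,
      div_eq_div_iff (pos ρ).ne' (pos ρ').ne'] at this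
    exact Subtype.ext (by linarith)
  rintro ⟨ρ, z⟩ ⟨ρ', z'⟩
  simp only
  constructor
  · intro h
    obtain rfl := ratio h
    refine ⟨rfl, fun h1 => ?_, fun h0 => ?_⟩
    · rcases ρ.2.1.eq_or_lt with h0 | h0
      · obtain rfl : ρ = 0 := Subtype.ext h0.symm
        exact root'.1 h
      · rw [ringSet_injective_of_mem_Ioo hm h0 h1 h]
    · rcases ρ.2.2.eq_or_lt with h1 | h1
      · obtain rfl : ρ = 1 := Subtype.ext h1
        exact root.1 h
      · rw [ringSet_injective_of_mem_Ioo hm h0 h1 h]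
  · rintro ⟨rfl, h₁, h₂⟩
    rcases ρ.2.1.eq_or_lt with h0 | h0
    · obtain rfl : ρ = 0 := Subtype.ext h0.symm
      exact root'.2 (h₁ zero_lt_one)
    rcases ρ.2.2.eq_or_lt with h1 | h1
    · obtain rfl : ρ = 1 := Subtype.ext h1
      exact root.2 (h₂ zero_lt_one)
    · rw [eq_of_pow_eq_pow_succ (h₁ h1) (h₂ h0)]

end Star

theorem mainTheorem3 (k : ℕ) [NeZero k] (hk : 2 ≤ k) :
    Nonempty (ContinuousMap.HomotopyEquiv (codimTwoComplement k)
      ((torusKnot (k - 1) k)ᶜ : Set ThreeSphere)) ∧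
    starImage k ⊆ codimTwoComplement k ∧
    IsDeformationRetract ((↑) ⁻¹' starImage k : Set (codimTwoComplement k)) ∧
    Nonempty (starImage k ≃ₜ TorusComplex k) := by
  obtain ⟨m, rfl⟩ : ∃ m, k = m + 1 := ⟨k - 1, by omega⟩
  have hm : 1 ≤ m := by omega
  have hm0 : m ≠ 0 := by omega
  have hsub := starImage_subset hm
  have hdef := isDeformationRetract_starImage hm
  obtain ⟨e₁⟩ := (isTorusCylinder_ringSet hm).nonempty_homeomorph hm (continuous_ringSet hm)
  obtain ⟨e₂⟩ := (isTorusCylinder_spineMap m).nonempty_homeomorph hm (continuous_spineMap m)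
  obtain ⟨f₁⟩ := hdef.nonempty_homotopyEquiv_of_subset hsub
  obtain ⟨f₂⟩ := (isDeformationRetract_spine hm0).nonempty_homotopyEquiv_of_subset
    (range_spineMap_subset hm0)
  rw [range_ringSet hm] at e₁
  exact ⟨⟨(f₁.symm.trans (e₁.trans e₂.symm).toHomotopyEquiv).trans f₂⟩, hsub, hdef, ⟨e₁⟩⟩
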